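/- Let $p$ be a prime. A fusion system $\mathcal F$ over a finite $p$-group $S$ is a category whose objects are the subgroups of $S$, with $\mathrm{Hom}_S(P,Q)\subseteq \mathrm{Hom}_{\mathcal F}(P,Q)\subseteq \mathrm{Inj}(P,Q)$ for all $P,Q\le S$, and in which each morphism is an $\mathcal F$-isomorphism followed by an inclusion. It is saturated if (I) each fully normalized $P\le S$ is fully centralized and has $\mathrm{Aut}_S(P)\in \mathrm{Syl}_p(\mathrm{Aut}_{\mathcal F}(P))$, and (II) each $\varphi\in\mathrm{Hom}_{\mathcal F}(P,S)$ with $\varphi(P)$ fully centralized extends to a morphism $N_\varphi\to S$ in $\mathcal F$, where $N_\varphi=\{g\in N_S(P)\mid \varphi c_g\varphi^{-1}\in\mathrm{Aut}_S(\varphi(P))\}$. A subgroup $P\trianglelefteq S$ is normal in $\mathcal F$ if every $\varphi\in\mathrm{Hom}_{\mathcal F}(Q,R)$ extends to some $\bar\varphi\in\mathrm{Hom}_{\mathcal F}(PQ,PR)$ with $\bar\varphi(P)=P$; $O_p(\mathcal F)$ is the largest such subgroup. Let $\mathrm{hyp}(\mathcal F)=\langle s^{-1}\alpha(s)\mid s\in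 P\le S,\ \alpha\in O^p(\mathrm{Aut}_{\mathcal F}(P))\rangle$. For saturated $\mathcal F$, a saturated fusion subsystem $\mathcal E\subseteq\mathcal F$ over $T\le S$ has $p$-power index if $\mathrm{hyp}(\mathcal F)\le T$ and $\mathrm{Aut}_{\mathcal E}(P)\ge O^p(\mathrm{Aut}_{\mathcal F}(P))$ for all $P\le T$; it has index prime to $p$ if $T=S$ and $\mathrm{Aut}_{\mathcal E}(P)\ge O^{p'}(\mathrm{Aut}_{\mathcal F}(P))$ for all $P\le S$. Here, for a finite group $A$, $O^p(A)$ and $O^{p'}(A)$ denote the smallest normal subgroups of $p$-power index and of index prime to $p$. Denote by $O^p(\mathcal F)$ the smallest saturated fusion subsystem of $p$-power index over $\mathrm{hyp}(\mathcal F)$, and by $O^{p'}(\mathcal F)$ the smallest saturated fusion subsystem of index prime to $p$. Call $\mathcal F$ reduced if it is saturated, $O_p(\mathcal F)=1$, $O^p(\mathcal F)=\mathcal F$ and $O^{p'}(\mathcal F)=\mathcal F$. Let $\mathcal F_1,\mathcal F_2$ be saturated fusion systems over finite $p$-groups $S_1,S_2$, and let $\mathcal F=\mathcal F_1\times\mathcal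 F_2$ be the fusion system over $S_1\times S_2$ in which $\mathrm{Hom}_{\mathcal F}(P,Q)$ is the set of all $(\varphi_1,\varphi_2)|_P$ with $\varphi_i\in\mathrm{Hom}_{\mathcal F_i}(P_i,Q_i)$ and $(\varphi_1,\varphi_2)(P)\le Q$, where $P_i,Q_i\le S_i$ are the projections of $P$ and $Q$. Then $\mathcal F$ is saturated, and $$O_p(\mathcal F)=O_p(\mathcal F_1)\times O_p(\mathcal F_2),\qquad O^p(\mathcal F)=O^p(\mathcal F_1)\times O^p(\mathcal F_2),\qquad O^{p'}(\mathcal F)=O^{p'}(\mathcal F_1)\times O^{p'}(\mathcal F_2).$$ The last two equalities mean: a fusion system $\mathcal E$ is the smallest subsystem of $\mathcal F$ of the stated kind if and only if $\mathcal E=\mathcal E_1\times\mathcal E_2$, where $\mathcal E_i$ is the smallest subsystem of $\mathcal F_i$ of that kind for $i=1,2$. Moreover, $\mathcal F$ is reduced if and only if $\mathcal F_1$ and $\mathcal F_2$ are both reduced. -/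

import Mathlib

/-- For a finite group `A`, the subgroup `O^p(A)`: the smallest normal subgroup of `A` whose index
is a power of `p`. -/
def pPowerResidual (p : ℕ) (A : Type*) [Group A] : Subgroup A :=
  sInf {N : Subgroup A | N.Normal ∧ ∃ k : ℕ, N.index = p ^ k}

/-- For a finite group `A`, the subgroup `O^{p'}(A)`: the smallest normal subgroup of `A` whose
index is prime to `p`. -/
def pPrimeResidual (p : ℕ) (A : Type*) [Group A] : Subgroup A :=
  sInf {N : Subgroup A | N.Normal ∧ N.index.Coprime p}

/-- A fusion system over a finite `p`-group `S`.  The group `S` (the field `carrier`) is a subgroup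
of an ambient group `G`, so that fusion systems over different subgroups of one group can be
compared; for a fusion system over an abstract finite `p`-group take `G = S` and `carrier = ⊤`.
The objects are the subgroups of `S`; there are no morphisms between subgroups of `G` which are
not contained in `S`. -/
@[ext]
structure FusionSystem (p : ℕ) (G : Type*) [Group G] where
  /-- The finite `p`-group `S` over which the fusion system is defined. -/
  carrier : Subgroup G
  /-- The set of morphisms from `P` to `Q`. -/
  Hom : ∀ P Q : Subgroup G, Set (P →* Q)
  finite_carrier : Finite carrier
  isPGroup_carrier : IsPGroup p carrier
  /-- The objects are the subgroups of `S`. -/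
  le_of_mem : ∀ {P Q : Subgroup G} {φ : P →* Q}, φ ∈ Hom P Q → P ≤ carrier ∧ Q ≤ carrier
  /-- Every morphism is an injective homomorphism. -/
  injective_of_mem : ∀ {P Q : Subgroup G} {φ : P →* Q}, φ ∈ Hom P Q → Function.Injective φ
  /-- Morphisms can be composed. -/
  comp_mem : ∀ {P Q R : Subgroup G} {φ : P →* Q} {ψ : Q →* R},
    φ ∈ Hom P Q → ψ ∈ Hom Q R → ψ.comp φ ∈ Hom P R
  /-- `Hom_S(P, Q) ⊆ Hom(P, Q)`: every homomorphism induced by conjugation by an element of `S`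
  is a morphism (in particular, so are inclusions and identities). -/
  conj_mem : ∀ {P Q : Subgroup G}, P ≤ carrier → Q ≤ carrier → ∀ c : P →* Q,
    (∃ g ∈ carrier, ∀ x : P, (c x : G) = g * x * g⁻¹) → c ∈ Hom P Q
  /-- Every morphism is the composite of an isomorphism of the category followed by an
  inclusion. -/
  exists_factor : ∀ {P Q : Subgroup G} {φ : P →* Q}, φ ∈ Hom P Q →
    ∃ (R : Subgroup G) (hR : R ≤ Q), ∃ χ ∈ Hom P R, ∃ ψ ∈ Hom R P,
      ψ.comp χ = MonoidHom.id P ∧ χ.comp ψ = MonoidHom.id R ∧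
      φ = (Subgroup.inclusion hR).comp χ

namespace FusionSystem

section Basic

variable {p : ℕ} {G : Type*} [Group G]

/-- `E ≤ F` means that `E` is a fusion subsystem of `F`, i.e. a subcategory over a subgroup of
the `p`-group of `F`. -/
instance : PartialOrder (FusionSystem p G) where
  le E F := E.carrier ≤ F.carrier ∧ ∀ P Q : Subgroup G, E.Hom P Q ⊆ F.Hom P Q
  le_refl _ := ⟨le_rfl, fun _ _ => subset_rfl⟩
  le_trans _ _ _ h h' := ⟨h.1.trans h'.1, fun P Q => (h.2 P Q).trans (h'.2 P Q)⟩
  le_antisymm _ _ h h' := FusionSystem.ext (le_antisymm h.1 h'.1)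
    (funext fun P => funext fun Q => subset_antisymm (h.2 P Q) (h'.2 P Q))

variable (F : FusionSystem p G)

/-- `P` and `Q` are `F`-conjugate: they are isomorphic in the category `F`. -/
def IsConj (P Q : Subgroup G) : Prop :=
  ∃ φ ∈ F.Hom P Q, ∃ ψ ∈ F.Hom Q P, ψ.comp φ = MonoidHom.id P ∧ φ.comp ψ = MonoidHom.id Q

/-- The group `Aut_F(P)` of automorphisms of `P ≤ S` in the category `F`. -/
def aut {P : Subgroup G} (hP : P ≤ F.carrier) : Subgroup (MulAut P) where
  carrier := {α | MulEquiv.toMonoidHom α ∈ F.Hom P P ∧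
    MulEquiv.toMonoidHom (MulEquiv.symm α) ∈ F.Hom P P}
  one_mem' := by
    have h : MonoidHom.id P ∈ F.Hom P P :=
      F.conj_mem hP hP _ ⟨1, one_mem _, fun x => by simp⟩
    exact ⟨h, h⟩
  mul_mem' := fun {_ _} ha hb => ⟨F.comp_mem hb.1 ha.1, F.comp_mem ha.2 hb.2⟩
  inv_mem' := fun {_} ha => ⟨ha.2, ha.1⟩

/-- The centralizer `C_S(P)`. -/
def centralizerIn (P : Subgroup G) : Subgroup G :=
  F.carrier ⊓ Subgroup.centralizer (P : Set G)

/-- The normalizer `N_S(P)`. -/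
def normalizerIn (P : Subgroup G) : Subgroup G :=
  F.carrier ⊓ Subgroup.normalizer (P : Set G)

/-- The group `Aut_S(P)` of automorphisms of `P` induced by conjugation by elements of `N_S(P)`. -/
def conjAut (P : Subgroup G) : Subgroup (MulAut P) where
  carrier := {α | ∃ g ∈ F.normalizerIn P, ∀ x : P, (α x : G) = g * x * g⁻¹}
  one_mem' := ⟨1, one_mem _, fun x => by simp⟩
  mul_mem' := by
    rintro a b ⟨g, hg, ha⟩ ⟨h, hh, hb⟩
    refine ⟨g * h, mul_mem hg hh, fun x => ?_⟩
    rw [MulAut.mul_apply, ha, hb]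
    group
  inv_mem' := by
    rintro a ⟨g, hg, ha⟩
    refine ⟨g⁻¹, inv_mem hg, fun x => ?_⟩
    have h := ha (a⁻¹ x)
    rw [MulAut.apply_inv_self] at h
    rw [h]
    group

/-- `P` is fully centralized in `F`. -/
def FullyCentralized (P : Subgroup G) : Prop :=
  ∀ P' : Subgroup G, F.IsConj P P' → Nat.card (F.centralizerIn P') ≤ Nat.card (F.centralizerIn P)

/-- `P` is fully normalized in `F`. -/
def FullyNormalized (P : Subgroup G) : Prop :=
  ∀ P' : Subgroup G, F.IsConj P P' → Nat.card (F.normalizerIn P') ≤ Nat.card (F.normalizerIn P)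

/-- The image `φ(P)` of a homomorphism `φ : P → Q` between subgroups of `G`, as a subgroup
of `G`. -/
def image {P Q : Subgroup G} (φ : P →* Q) : Subgroup G :=
  φ.range.map Q.subtype

/-- For `φ : P → Q`, the group `N_φ` of all `g ∈ N_S(P)` such that `φ c_g φ⁻¹ ∈ Aut_S(φ(P))`,
i.e. such that for some `h ∈ N_S(φ(P))` we have `φ ∘ c_g = c_h ∘ φ` on `P`. -/
def extensionSubgroup {P Q : Subgroup G} (φ : P →* Q) : Subgroup G where
  carrier := {g | g ∈ F.normalizerIn P ∧ ∃ h ∈ F.normalizerIn (image φ),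
    ∀ x y : P, (y : G) = g * x * g⁻¹ → (φ y : G) = h * φ x * h⁻¹}
  one_mem' := ⟨one_mem _, 1, one_mem _, fun x y hy => by
    have : y = x := Subtype.ext (by simpa using hy)
    simp [this]⟩
  mul_mem' := by
    rintro a b ⟨ha, a', ha', hφa⟩ ⟨hb, b', hb', hφb⟩
    refine ⟨mul_mem ha hb, a' * b', mul_mem ha' hb', fun x y hy => ?_⟩
    have hz : b * x * b⁻¹ ∈ P := (Subgroup.mem_normalizer_iff.1 hb.2 x).1 x.2
    have h1 := hφb x ⟨_, hz⟩ rfl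
    have h2 := hφa ⟨_, hz⟩ y (by rw [hy]; group)
    rw [h2, h1]
    group
  inv_mem' := by
    rintro a ⟨ha, a', ha', hφa⟩
    refine ⟨inv_mem ha, a'⁻¹, inv_mem ha', fun x y hy => ?_⟩
    have h1 := hφa y x (by rw [hy]; group)
    rw [h1]
    group

theorem le_extensionSubgroup {P Q : Subgroup G} (φ : P →* Q) (hP : P ≤ F.carrier)
    (hQ : Q ≤ F.carrier) : P ≤ F.extensionSubgroup φ := by
  intro g hg
  have hmem : ((φ ⟨g, hg⟩ : Q) : G) ∈ image φ := ⟨φ ⟨g, hg⟩, ⟨_, rfl⟩, rfl⟩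
  refine ⟨⟨hP hg, Subgroup.le_normalizer hg⟩, φ ⟨g, hg⟩,
    ⟨hQ (φ ⟨g, hg⟩).2, Subgroup.le_normalizer hmem⟩, fun x y hy => ?_⟩
  have : y = ⟨g, hg⟩ * x * ⟨g, hg⟩⁻¹ := Subtype.ext (by simpa using hy)
  rw [this]
  simp

/-- The fusion system `F` over `S` is saturated. -/
structure Saturated : Prop where
  /-- If `P` is fully normalized, then it is fully centralized and `Aut_S(P)` is a Sylow
  `p`-subgroup of `Aut_F(P)`. -/
  sylow : ∀ (P : Subgroup G) (hP : P ≤ F.carrier), F.FullyNormalized P →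
    F.FullyCentralized P ∧
      ∃ T : Sylow p (F.aut hP), (T : Subgroup (F.aut hP)) = (F.conjAut P).subgroupOf (F.aut hP)
  /-- If `φ(P)` is fully centralized, then `φ ∈ Hom_F(P, S)` extends to a morphism
  `N_φ → S`. -/
  extension : ∀ (P : Subgroup G) (hP : P ≤ F.carrier) (φ : P →* F.carrier),
    φ ∈ F.Hom P F.carrier → F.FullyCentralized (image φ) →
    ∃ ψ ∈ F.Hom (F.extensionSubgroup φ) F.carrier,
      ψ.comp (Subgroup.inclusion (F.le_extensionSubgroup φ hP le_rfl)) = φ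

/-- `P` is normal in `F`: `P` is a normal subgroup of `S`, and every morphism `φ : Q → R` of `F`
extends to a morphism `ψ : PQ → PR` of `F` with `ψ(P) = P`. -/
def IsNormalSubgroup (P : Subgroup G) : Prop :=
  P ≤ F.carrier ∧ (P.subgroupOf F.carrier).Normal ∧
    ∀ (Q R : Subgroup G) (φ : Q →* R), φ ∈ F.Hom Q R →
      ∃ ψ ∈ F.Hom (P ⊔ Q) (P ⊔ R),
        ψ.comp (Subgroup.inclusion le_sup_right) = (Subgroup.inclusion le_sup_right).comp φ ∧
        (P.subgroupOf (P ⊔ Q)).map ψ = P.subgroupOf (P ⊔ R)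

/-- `O_p(F)`, the largest subgroup of `S` which is normal in `F`.  (A product of two normal
subgroups is normal, so the supremum is the largest one.) -/
def core : Subgroup G :=
  sSup {P | F.IsNormalSubgroup P}

/-- The hyperfocal subgroup `hyp(F) = ⟨s⁻¹ α(s) | s ∈ P ≤ S, α ∈ O^p(Aut_F(P))⟩`. -/
def hyperfocal : Subgroup G :=
  Subgroup.closure {x | ∃ (P : Subgroup G) (hP : P ≤ F.carrier),
    ∃ α ∈ pPowerResidual p (F.aut hP), ∃ s : P, x = (s : G)⁻¹ * ((α : MulAut P) s : G)}

/-- `E` is a saturated fusion subsystem of `F` of `p`-power index. -/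
structure HasPPowerIndex (E : FusionSystem p G) : Prop where
  saturated : E.Saturated
  le : E ≤ F
  hyperfocal_le : F.hyperfocal ≤ E.carrier
  residual_le : ∀ (P : Subgroup G) (hP : P ≤ E.carrier),
    (pPowerResidual p (F.aut (hP.trans le.1))).map (F.aut (hP.trans le.1)).subtype ≤ E.aut hP

/-- `E` is a saturated fusion subsystem of `F` of index prime to `p`. -/
structure HasIndexPrimeTo (E : FusionSystem p G) : Prop where
  saturated : E.Saturated
  le : E ≤ F
  carrier_eq : E.carrier = F.carrier
  residual_le : ∀ (P : Subgroup G) (hP : P ≤ E.carrier),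
    (pPrimeResidual p (F.aut (hP.trans le.1))).map (F.aut (hP.trans le.1)).subtype ≤ E.aut hP

/-- `E = O^p(F)`: `E` is the unique minimal (that is, the least) saturated fusion subsystem of
`p`-power index in `F` over `hyp(F)`. -/
def IsOPowerP (E : FusionSystem p G) : Prop :=
  IsLeast {D : FusionSystem p G | F.HasPPowerIndex D ∧ D.carrier = F.hyperfocal} E

/-- `E = O^{p'}(F)`: `E` is the unique minimal (that is, the least) saturated fusion subsystem of
index prime to `p` in `F`. -/
def IsOPowerPPrime (E : FusionSystem p G) : Prop :=
  IsLeast {D : FusionSystem p G | F.HasIndexPrimeTo D} E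

/-- `F` is reduced: it is saturated, `O_p(F) = 1`, `O^p(F) = F` and `O^{p'}(F) = F`. -/
structure Reduced : Prop where
  saturated : F.Saturated
  core_eq : F.core = ⊥
  oPowerP : F.IsOPowerP F
  oPowerPPrime : F.IsOPowerPPrime F

end Basic

section Prod

variable {p : ℕ} {G₁ G₂ : Type*} [Group G₁] [Group G₂]

/-- The image of `P ≤ G₁ × G₂` under projection to `G₁`. -/
abbrev proj₁ (P : Subgroup (G₁ × G₂)) : Subgroup G₁ := P.map (MonoidHom.fst G₁ G₂)

/-- The image of `P ≤ G₁ × G₂` under projection to `G₂`. -/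
abbrev proj₂ (P : Subgroup (G₁ × G₂)) : Subgroup G₂ := P.map (MonoidHom.snd G₁ G₂)

/-- The projection `P → P₁`. -/
def toProj₁ (P : Subgroup (G₁ × G₂)) : P →* proj₁ P := (MonoidHom.fst G₁ G₂).subgroupMap P

/-- The projection `P → P₂`. -/
def toProj₂ (P : Subgroup (G₁ × G₂)) : P →* proj₂ P := (MonoidHom.snd G₁ G₂).subgroupMap P

/-- `φ : P → Q` is the restriction to `P ≤ P₁ × P₂` of `(φ₁, φ₂) : P₁ × P₂ → Q₁ × Q₂`. -/
def IsRestriction {P Q : Subgroup (G₁ × G₂)} (φ : P →* Q) (φ₁ : proj₁ P →* proj₁ Q)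
    (φ₂ : proj₂ P →* proj₂ Q) : Prop :=
  ∀ x : P, (φ x : G₁ × G₂) = ((φ₁ (toProj₁ P x) : G₁), (φ₂ (toProj₂ P x) : G₂))

/-- The product fusion system `F₁ × F₂` over `S₁ × S₂`: the morphisms `P → Q` are the
homomorphisms `(φ₁, φ₂)|_P` with `φᵢ ∈ Hom_{Fᵢ}(Pᵢ, Qᵢ)` which send `P` into `Q`, where `Pᵢ`
and `Qᵢ` are the projections of `P` and `Q`. -/
def prod (F₁ : FusionSystem p G₁) (F₂ : FusionSystem p G₂) : FusionSystem p (G₁ × G₂) where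
  carrier := F₁.carrier.prod F₂.carrier
  Hom P Q := {φ | ∃ φ₁ ∈ F₁.Hom (proj₁ P) (proj₁ Q), ∃ φ₂ ∈ F₂.Hom (proj₂ P) (proj₂ Q),
    IsRestriction φ φ₁ φ₂}
  finite_carrier := by
    have := F₁.finite_carrier
    have := F₂.finite_carrier
    exact Finite.of_equiv _ (Subgroup.prodEquiv F₁.carrier F₂.carrier).symm.toEquiv
  isPGroup_carrier := by
    rintro ⟨⟨a, b⟩, ha, hb⟩
    obtain ⟨k, hk⟩ := F₁.isPGroup_carrier ⟨a, ha⟩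
    obtain ⟨l, hl⟩ := F₂.isPGroup_carrier ⟨b, hb⟩
    have hk' : a ^ p ^ k = 1 := by simpa using congrArg Subtype.val hk
    have hl' : b ^ p ^ l = 1 := by simpa using congrArg Subtype.val hl
    refine ⟨k + l, Subtype.ext (Prod.ext ?_ ?_)⟩
    · simp [pow_add, pow_mul, hk']
    · simp [pow_add, mul_comm (p ^ k), pow_mul, hl']
  le_of_mem := by
    rintro P Q φ ⟨φ₁, h₁, φ₂, h₂, -⟩
    have a := F₁.le_of_mem h₁
    have b := F₂.le_of_mem h₂
    exact ⟨fun x hx => ⟨a.1 ⟨x, hx, rfl⟩, b.1 ⟨x, hx, rfl⟩⟩,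
      fun x hx => ⟨a.2 ⟨x, hx, rfl⟩, b.2 ⟨x, hx, rfl⟩⟩⟩
  injective_of_mem := by
    rintro P Q φ ⟨φ₁, h₁, φ₂, h₂, h⟩ x y hxy
    have hx := h x
    rw [hxy, h y, Prod.mk.injEq] at hx
    have a := F₁.injective_of_mem h₁ (Subtype.ext hx.1)
    have b := F₂.injective_of_mem h₂ (Subtype.ext hx.2)
    exact Subtype.ext (Prod.ext (congrArg Subtype.val a).symm (congrArg Subtype.val b).symm)
  comp_mem := by
    rintro P Q R φ ψ ⟨φ₁, h₁, φ₂, h₂, h⟩ ⟨ψ₁, k₁, ψ₂, k₂, k⟩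
    refine ⟨_, F₁.comp_mem h₁ k₁, _, F₂.comp_mem h₂ k₂, fun x => ?_⟩
    have e₁ : toProj₁ Q (φ x) = φ₁ (toProj₁ P x) := Subtype.ext (congrArg Prod.fst (h x))
    have e₂ : toProj₂ Q (φ x) = φ₂ (toProj₂ P x) := Subtype.ext (congrArg Prod.snd (h x))
    rw [MonoidHom.comp_apply, k (φ x), e₁, e₂]
    rfl
  conj_mem := by
    rintro P Q hP hQ c ⟨g, hg, hc⟩
    have hP₁ : proj₁ P ≤ F₁.carrier := by rintro _ ⟨x, hx, rfl⟩; exact (hP hx).1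
    have hP₂ : proj₂ P ≤ F₂.carrier := by rintro _ ⟨x, hx, rfl⟩; exact (hP hx).2
    have hQ₁ : proj₁ Q ≤ F₁.carrier := by rintro _ ⟨x, hx, rfl⟩; exact (hQ hx).1
    have hQ₂ : proj₂ Q ≤ F₂.carrier := by rintro _ ⟨x, hx, rfl⟩; exact (hQ hx).2
    have m₁ : ∀ x : proj₁ P, MulAut.conj g.1 x.1 ∈ proj₁ Q := by
      rintro ⟨_, x, hx, rfl⟩
      exact ⟨c ⟨x, hx⟩, (c ⟨x, hx⟩).2, by rw [hc]; rfl⟩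
    have m₂ : ∀ x : proj₂ P, MulAut.conj g.2 x.1 ∈ proj₂ Q := by
      rintro ⟨_, x, hx, rfl⟩
      exact ⟨c ⟨x, hx⟩, (c ⟨x, hx⟩).2, by rw [hc]; rfl⟩
    exact ⟨((MulAut.conj g.1).toMonoidHom.comp (proj₁ P).subtype).codRestrict _ m₁,
      F₁.conj_mem hP₁ hQ₁ _ ⟨g.1, hg.1, fun x => rfl⟩,
      ((MulAut.conj g.2).toMonoidHom.comp (proj₂ P).subtype).codRestrict _ m₂,
      F₂.conj_mem hP₂ hQ₂ _ ⟨g.2, hg.2, fun x => rfl⟩, fun x => hc x⟩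
  exists_factor := by
    rintro P Q φ ⟨φ₁, h₁, φ₂, h₂, h⟩
    obtain ⟨R₁, hR₁, χ₁, hχ₁, ψ₁, hψ₁, a₁, b₁, c₁⟩ := F₁.exists_factor h₁
    obtain ⟨R₂, hR₂, χ₂, hχ₂, ψ₂, hψ₂, a₂, b₂, c₂⟩ := F₂.exists_factor h₂
    have h' : ∀ x : P, (φ x : G₁ × G₂) =
        ((χ₁ (toProj₁ P x) : G₁), (χ₂ (toProj₂ P x) : G₂)) := by
      intro x
      rw [h x, c₁, c₂]
      rfl
    have e₁ : proj₁ (image φ) = R₁ := by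
      ext y
      constructor
      · rintro ⟨_, ⟨_, ⟨x, rfl⟩, rfl⟩, rfl⟩
        have := congrArg Prod.fst (h' x)
        change (φ x : G₁ × G₂).1 ∈ R₁
        rw [this]
        exact (χ₁ _).2
      · intro hy
        obtain ⟨x, hx, hxe⟩ := (ψ₁ ⟨y, hy⟩).2
        refine ⟨φ ⟨x, hx⟩, ⟨φ ⟨x, hx⟩, ⟨_, rfl⟩, rfl⟩, ?_⟩
        have e : toProj₁ P ⟨x, hx⟩ = ψ₁ ⟨y, hy⟩ := Subtype.ext hxe
        change (φ ⟨x, hx⟩ : G₁ × G₂).1 = y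
        rw [h', e]
        exact congrArg Subtype.val (DFunLike.congr_fun b₁ ⟨y, hy⟩)
    have e₂ : proj₂ (image φ) = R₂ := by
      ext y
      constructor
      · rintro ⟨_, ⟨_, ⟨x, rfl⟩, rfl⟩, rfl⟩
        have := congrArg Prod.snd (h' x)
        change (φ x : G₁ × G₂).2 ∈ R₂
        rw [this]
        exact (χ₂ _).2
      · intro hy
        obtain ⟨x, hx, hxe⟩ := (ψ₂ ⟨y, hy⟩).2
        refine ⟨φ ⟨x, hx⟩, ⟨φ ⟨x, hx⟩, ⟨_, rfl⟩, rfl⟩, ?_⟩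
        have e : toProj₂ P ⟨x, hx⟩ = ψ₂ ⟨y, hy⟩ := Subtype.ext hxe
        change (φ ⟨x, hx⟩ : G₁ × G₂).2 = y
        rw [h', e]
        exact congrArg Subtype.val (DFunLike.congr_fun b₂ ⟨y, hy⟩)
    subst e₁ e₂
    have hinj : Function.Injective φ := by
      intro x y hxy
      have hx := h' x
      rw [hxy, h' y, Prod.mk.injEq] at hx
      have a := F₁.injective_of_mem hχ₁ (Subtype.ext hx.1)
      have b := F₂.injective_of_mem hχ₂ (Subtype.ext hx.2)
      exact Subtype.ext (Prod.ext (congrArg Subtype.val a).symm (congrArg Subtype.val b).symm)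
    let χ : P →* image φ :=
      (Q.subtype.comp φ).codRestrict (image φ) fun x => ⟨φ x, ⟨x, rfl⟩, rfl⟩
    have hχ : Function.Bijective χ := by
      constructor
      · intro x y hxy
        have hv : (χ x : G₁ × G₂) = χ y := congrArg Subtype.val hxy
        exact hinj (Subtype.ext hv)
      · rintro ⟨_, _, ⟨x, rfl⟩, rfl⟩
        exact ⟨x, rfl⟩
    let e := MulEquiv.ofBijective χ hχ
    have hle : image φ ≤ Q := by
      rintro _ ⟨q, -, rfl⟩
      exact q.2
    have t₁ : ∀ x : P, toProj₁ (image φ) (χ x) = χ₁ (toProj₁ P x) :=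
      fun x => Subtype.ext (congrArg Prod.fst (h' x))
    have t₂ : ∀ x : P, toProj₂ (image φ) (χ x) = χ₂ (toProj₂ P x) :=
      fun x => Subtype.ext (congrArg Prod.snd (h' x))
    refine ⟨image φ, hle, χ, ⟨χ₁, hχ₁, χ₂, hχ₂, h'⟩, e.symm.toMonoidHom,
      ⟨ψ₁, hψ₁, ψ₂, hψ₂, fun y => ?_⟩, ?_, ?_, ?_⟩
    · obtain ⟨x, rfl⟩ := hχ.2 y
      have ex : e.symm (χ x) = x := e.symm_apply_apply x
      have u₁ : ψ₁ (χ₁ (toProj₁ P x)) = toProj₁ P x := DFunLike.congr_fun a₁ _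
      have u₂ : ψ₂ (χ₂ (toProj₂ P x)) = toProj₂ P x := DFunLike.congr_fun a₂ _
      rw [t₁, t₂, u₁, u₂]
      change ((e.symm (χ x) : P) : G₁ × G₂) = _
      rw [ex]
      rfl
    · exact MonoidHom.ext fun x => e.symm_apply_apply x
    · exact MonoidHom.ext fun y => e.apply_symm_apply y
    · exact MonoidHom.ext fun x => Subtype.ext rfl

end Prod

end FusionSystem

namespace FusionSystem

/-! ### Isomorphisms, automizers, and the count behind the Sylow axiom -/

section Basic

variable {p : ℕ} {G : Type*} [Group G] (F : FusionSystem p G)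

/-! Saturation of the product. A subgroup `P ≤ S₁ × S₂` need not be a product, but its centralizer
is: `C_S(P) = C_{S₁}(P₁) × C_{S₂}(P₂)`. For the Sylow axiom, project a Sylow subgroup of `Aut_F(P)`
to `p`-subgroups of the `Aut_{Fᵢ}(Pᵢ)`, conjugate these into `Aut_{Sᵢ}(Pᵢ')` with `Pᵢ'` fully
centralized (`Saturated.exists_conj`), and pair the two isomorphisms; a count with `|N_S| = |C_S|
|Aut_S|` finishes (`FullyNormalized.sylow_of_conj`). For the extension axiom, `N_φ` projects into
each `N_{φᵢ}`, so the extensions of the components can be paired and restricted.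

`O_p`: projections of normal subgroups are normal, and so are products of normal subgroups.

`O^p` and `O^{p'}`: pairing subsystems of the required kind gives one of the product. Conversely a
subsystem `D` over `T₁ × T₂` has factors `D₁`, `D₂`, where `D₁` consists of the `φ` with `(φ,
id_{T₂})` in `D`, and symmetrically. Keeping the whole of `T₂` in the source gives `D₁ × D₂ ≤ D`,
because `(φ₁, φ₂)` is the composite of `(φ₁, id)` and `(id, φ₂)`. The hard point is that `D₁` is
saturated (`Splits.saturated_factor`); it rests on correcting any isomorphism from `P × T₂` by an
endomorphism of `T₁ × T₂` in `D`, so that it becomes the identity on `T₂` (`Splits.exists_untwist`).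
Since both kinds of subsystem pass between the product and the factors, least elements correspond
formally (`isLeast_prod_iff`), and the criterion for being reduced follows. -/

theorem inclusion_mem {P Q : Subgroup G} (h : P ≤ Q) (hQ : Q ≤ F.carrier) :
    Subgroup.inclusion h ∈ F.Hom P Q :=
  F.conj_mem (h.trans hQ) hQ _ ⟨1, one_mem _, fun x => by simp⟩

/-- Restricting a morphism of `F`, and enlarging or shrinking its target, gives a morphism
of `F`. -/
theorem mem_of_restrict {P Q P' Q' : Subgroup G} {φ : P →* Q} (hφ : φ ∈ F.Hom P Q) (hP : P' ≤ P)
    (hQ : Q' ≤ F.carrier) (ψ : P' →* Q') (h : ∀ x : P', (ψ x : G) = φ ⟨x, hP x.2⟩) :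
    ψ ∈ F.Hom P' Q' := by
  have hle := F.le_of_mem hφ
  obtain ⟨R, hR, χ, hχ, ψ', hψ', h1, h2, h3⟩ :=
    F.exists_factor (F.comp_mem (F.inclusion_mem hP hle.1) hφ)
  have hv : ∀ x : P', (ψ x : G) = χ x := fun x => by
    rw [h x]
    exact congrArg Subtype.val (DFunLike.congr_fun h3 x)
  have hRQ : R ≤ Q' := fun y hy => by
    have e : χ (ψ' ⟨y, hy⟩) = ⟨y, hy⟩ := DFunLike.congr_fun h2 _
    have := hv (ψ' ⟨y, hy⟩)
    rw [e] at this
    change _ = y at this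
    rw [← this]
    exact (ψ _).2
  have : ψ = (Subgroup.inclusion hRQ).comp χ := MonoidHom.ext fun x => Subtype.ext (hv x)
  rw [this]
  exact F.comp_mem hχ (F.inclusion_mem hRQ hQ)

/-- Surjectivity forces the intermediate subgroup of the factorization to be `Q`, so the inverse
supplied there is `e⁻¹`. Hence membership in `aut` or conjugacy needs a check in one direction only.
-/
theorem symm_mem {P Q : Subgroup G} {e : P ≃* Q} (he : e.toMonoidHom ∈ F.Hom P Q) :
    e.symm.toMonoidHom ∈ F.Hom Q P := by
  obtain ⟨R, hR, χ, hχ, ψ, hψ, h1, h2, h3⟩ := F.exists_factor he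
  have hv : ∀ x : P, (e x : G) = χ x := fun x =>
    congrArg Subtype.val (DFunLike.congr_fun h3 x)
  obtain rfl : R = Q := le_antisymm hR fun y hy => by
    have := hv (e.symm ⟨y, hy⟩)
    rw [e.apply_symm_apply] at this
    change y = _ at this
    rw [this]
    exact (χ _).2
  have : e.symm.toMonoidHom = ψ := MonoidHom.ext fun y => by
    have hy : χ (ψ y) = y := DFunLike.congr_fun h2 y
    have := hv (ψ y)
    rw [hy] at this
    exact (e.symm_apply_eq).2 (Subtype.ext this.symm)
  rw [this]
  exact hψ

variable {F}

theorem mem_aut_iff {P : Subgroup G} (hP : P ≤ F.carrier) {α : MulAut P} :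
    α ∈ F.aut hP ↔ MulEquiv.toMonoidHom α ∈ F.Hom P P :=
  ⟨fun h => h.1, fun h => ⟨h, F.symm_mem h⟩⟩

theorem isConj_iff {P Q : Subgroup G} :
    F.IsConj P Q ↔ ∃ e : P ≃* Q, e.toMonoidHom ∈ F.Hom P Q := by
  constructor
  · rintro ⟨φ, hφ, ψ, hψ, h1, h2⟩
    exact ⟨MonoidHom.toMulEquiv φ ψ h1 h2, hφ⟩
  · rintro ⟨e, he⟩
    exact ⟨_, he, _, F.symm_mem he, MonoidHom.ext e.symm_apply_apply,
      MonoidHom.ext e.apply_symm_apply⟩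

theorem IsConj.refl {P : Subgroup G} (hP : P ≤ F.carrier) : F.IsConj P P :=
  isConj_iff.2 ⟨MulEquiv.refl P, F.inclusion_mem le_rfl hP⟩

theorem IsConj.trans {P Q R : Subgroup G} (h : F.IsConj P Q) (h' : F.IsConj Q R) :
    F.IsConj P R := by
  obtain ⟨e, he⟩ := isConj_iff.1 h
  obtain ⟨e', he'⟩ := isConj_iff.1 h'
  exact isConj_iff.2 ⟨e.trans e', F.comp_mem he he'⟩

theorem IsConj.symm {P Q : Subgroup G} (h : F.IsConj P Q) : F.IsConj Q P := by
  obtain ⟨e, he⟩ := isConj_iff.1 h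
  exact isConj_iff.2 ⟨e.symm, F.symm_mem he⟩

theorem IsConj.le {P Q : Subgroup G} (h : F.IsConj P Q) : P ≤ F.carrier ∧ Q ≤ F.carrier := by
  obtain ⟨φ, hφ, -⟩ := h
  exact F.le_of_mem hφ

/-- A morphism, viewed as an isomorphism onto its image. -/
noncomputable def equivImage {P Q : Subgroup G} (φ : P →* Q) (hφ : Function.Injective φ) :
    P ≃* image φ :=
  (MonoidHom.ofInjective hφ).trans (φ.range.equivMapOfInjective Q.subtype Subtype.val_injective)

theorem image_le {P Q : Subgroup G} (φ : P →* Q) : image φ ≤ Q := by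
  rintro _ ⟨y, -, rfl⟩
  exact y.2

theorem mem_image {P Q : Subgroup G} {φ : P →* Q} {y : G} : y ∈ image φ ↔ ∃ x, (φ x : G) = y := by
  constructor
  · rintro ⟨_, ⟨x, rfl⟩, rfl⟩
    exact ⟨x, rfl⟩
  · rintro ⟨x, rfl⟩
    exact ⟨_, ⟨x, rfl⟩, rfl⟩

theorem equivImage_mem {P Q : Subgroup G} {φ : P →* Q} (hφ : φ ∈ F.Hom P Q) :
    (equivImage φ (F.injective_of_mem hφ)).toMonoidHom ∈ F.Hom P (image φ) :=
  F.mem_of_restrict hφ le_rfl ((image_le φ).trans (F.le_of_mem hφ).2) _ fun _ => rfl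

theorem finite_of_le {P : Subgroup G} (hP : P ≤ F.carrier) : Finite P :=
  have := F.finite_carrier
  Finite.of_injective _ (Subgroup.inclusion_injective hP)

theorem centralizerIn_le (P : Subgroup G) : F.centralizerIn P ≤ F.carrier := inf_le_left

theorem mem_centralizerIn {P : Subgroup G} {x : G} :
    x ∈ F.centralizerIn P ↔ x ∈ F.carrier ∧ ∀ y ∈ P, y * x = x * y := by
  rw [centralizerIn, Subgroup.mem_inf, Subgroup.mem_centralizer_iff]
  rfl

theorem normalizerIn_le (P : Subgroup G) : F.normalizerIn P ≤ F.carrier := inf_le_left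

theorem FullyCentralized.of_card_le {P Q : Subgroup G} (hQ : F.FullyCentralized Q)
    (h : F.IsConj Q P) (hc : Nat.card (F.centralizerIn Q) ≤ Nat.card (F.centralizerIn P)) :
    F.FullyCentralized P :=
  fun R hR => (hQ R (h.trans hR)).trans hc

/-- An endomorphism of `S` in `F` carrying `R` onto `R'` embeds `C_S(R)` into `C_S(R')`. -/
theorem card_centralizerIn_le {β : F.carrier →* F.carrier} (hβ : β ∈ F.Hom F.carrier F.carrier)
    {R R' : Subgroup G} (hR : R ≤ F.carrier)
    (h : ∀ y ∈ R', ∃ (x : G) (hx : x ∈ R), (β ⟨x, hR hx⟩ : G) = y) :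
    Nat.card (F.centralizerIn R) ≤ Nat.card (F.centralizerIn R') := by
  have := finite_of_le (F.centralizerIn_le R')
  have hm : ∀ x : F.centralizerIn R, (β ⟨x, F.centralizerIn_le R x.2⟩ : G) ∈ F.centralizerIn R' := by
    intro x
    refine mem_centralizerIn.2 ⟨(β _).2, fun y hy => ?_⟩
    obtain ⟨r, hr, rfl⟩ := h y hy
    have := (mem_centralizerIn.1 x.2).2 r hr
    have e : (⟨r, hR hr⟩ * ⟨x, F.centralizerIn_le R x.2⟩ : F.carrier) =
      ⟨x, F.centralizerIn_le R x.2⟩ * ⟨r, hR hr⟩ := Subtype.ext this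
    have := congrArg Subtype.val (congrArg β e)
    rwa [map_mul, map_mul] at this
  refine Nat.card_le_card_of_injective
    (fun x => (⟨_, hm x⟩ : F.centralizerIn R')) fun x y hxy => ?_
  have hv : β ⟨x, F.centralizerIn_le R x.2⟩ = β ⟨y, F.centralizerIn_le R y.2⟩ :=
    Subtype.ext (Subtype.mk.inj hxy)
  exact Subtype.ext (Subtype.mk.inj (F.injective_of_mem hβ hv))

/-- Conjugation by `h` agrees on `P'` with the bijection `e' ∘ e⁻¹` of `P'`. Normalizing is
therefore automatic for an element inducing an automorphism. -/
theorem mem_normalizerIn_of_forall {P P' : Subgroup G} {h : G} (hh : h ∈ F.carrier) (e e' : P ≃* P')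
    (H : ∀ x : P, (e' x : G) = h * e x * h⁻¹) : h ∈ F.normalizerIn P' := by
  refine ⟨hh, Subgroup.mem_normalizer_iff.2 fun y => ⟨fun hy => ?_, fun hy => ?_⟩⟩
  · have := H (e.symm ⟨y, hy⟩)
    rw [e.apply_symm_apply] at this
    rw [← this]
    exact (e' _).2
  · have := H (e'.symm ⟨_, hy⟩)
    rw [e'.apply_symm_apply] at this
    have h2 : y = e (e'.symm ⟨_, hy⟩) := by simpa using this
    rw [h2]
    exact (e _).2

theorem mem_conjAut_iff {P : Subgroup G} {α : MulAut P} :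
    α ∈ F.conjAut P ↔ ∃ g ∈ F.carrier, ∀ x : P, (α x : G) = g * x * g⁻¹ :=
  ⟨fun ⟨g, hg, h⟩ => ⟨g, hg.1, h⟩, fun ⟨g, hg, h⟩ =>
    ⟨g, mem_normalizerIn_of_forall hg (MulEquiv.refl P) α h, h⟩⟩

theorem conjAut_le_aut {P : Subgroup G} (hP : P ≤ F.carrier) : F.conjAut P ≤ F.aut hP := by
  rintro α ⟨g, hg, h⟩
  exact (mem_aut_iff hP).2 (F.conj_mem hP hP _ ⟨g, hg.1, h⟩)

/-- The conjugation homomorphism `N_S(P) → Aut(P)`. -/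
def conjHom (F : FusionSystem p G) (P : Subgroup G) : F.normalizerIn P →* MulAut P :=
  P.normalizerMonoidHom.comp (Subgroup.inclusion inf_le_right)

theorem coe_conjHom {P : Subgroup G} (g : F.normalizerIn P) (x : P) :
    (F.conjHom P g x : G) = g * x * (g : G)⁻¹ := rfl

theorem conjHom_range (P : Subgroup G) : (F.conjHom P).range = F.conjAut P := by
  ext α
  constructor
  · rintro ⟨g, rfl⟩
    exact ⟨g, g.2, fun x => coe_conjHom g x⟩
  · rintro ⟨g, hg, h⟩
    exact ⟨⟨g, hg⟩, MulEquiv.ext fun x => Subtype.ext (h x).symm⟩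

theorem centralizerIn_le_normalizerIn (P : Subgroup G) :
    F.centralizerIn P ≤ F.normalizerIn P :=
  inf_le_inf_left _ (Subgroup.centralizer_le_normalizer _)

theorem conjHom_ker (P : Subgroup G) :
    (F.conjHom P).ker = (F.centralizerIn P).subgroupOf (F.normalizerIn P) := by
  ext g
  rw [MonoidHom.mem_ker, Subgroup.mem_subgroupOf, mem_centralizerIn]
  constructor
  · intro h
    refine ⟨g.2.1, fun y hy => ?_⟩
    have := coe_conjHom g ⟨y, hy⟩
    rw [h] at this
    exact eq_mul_inv_iff_mul_eq.1 this
  · rintro ⟨-, h⟩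
    refine MulEquiv.ext fun x => Subtype.ext ?_
    rw [coe_conjHom]
    exact (eq_mul_inv_iff_mul_eq.2 (h x x.2)).symm

theorem card_normalizerIn (P : Subgroup G) :
    Nat.card (F.normalizerIn P) = Nat.card (F.centralizerIn P) * Nat.card (F.conjAut P) := by
  rw [← (F.conjHom P).ker.card_mul_index, Subgroup.index_ker, conjHom_range, conjHom_ker,
    Nat.card_congr (Subgroup.subgroupOfEquivOfLe (centralizerIn_le_normalizerIn P)).toEquiv]

theorem isPGroup_conjAut (P : Subgroup G) : IsPGroup p (F.conjAut P) := by
  rw [← conjHom_range]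
  exact (F.isPGroup_carrier.to_le (F.normalizerIn_le P)).of_surjective _
    (F.conjHom P).rangeRestrict_surjective

theorem finite_aut {P : Subgroup G} (hP : P ≤ F.carrier) : Finite (F.aut hP) := by
  have := finite_of_le hP
  have : Finite (MulAut P) :=
    Finite.of_injective (fun e : MulAut P => (e : P → P)) DFunLike.coe_injective
  infer_instance

/-- If `P` is fully normalized, and for some Sylow `p`-subgroup `Q` of `Aut_F(P)` there is an
isomorphism `e : P → P'` in `F` with `P'` fully centralized and `e Q e⁻¹ ≤ Aut_S(P')`, then `P` is
fully centralized and `Aut_S(P)` is a Sylow `p`-subgroup of `Aut_F(P)`. -/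
theorem FullyNormalized.sylow_of_conj [Fact p.Prime] {P P' : Subgroup G} (hP : P ≤ F.carrier)
    (hn : F.FullyNormalized P) {e : P ≃* P'} (he : e.toMonoidHom ∈ F.Hom P P')
    (hc : F.FullyCentralized P') (Q : Sylow p (F.aut hP))
    (hQ : ∀ α ∈ Q, ∃ h ∈ F.carrier, ∀ x : P, (e ((α : MulAut P) x) : G) = h * e x * h⁻¹) :
    F.FullyCentralized P ∧
      ∃ T : Sylow p (F.aut hP), (T : Subgroup (F.aut hP)) = (F.conjAut P).subgroupOf (F.aut hP) := by
  have := finite_aut hP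
  have hPP' : F.IsConj P P' := isConj_iff.2 ⟨e, he⟩
  have hP' := hPP'.le.2
  have := finite_aut hP'
  have : Finite (F.conjAut P') :=
    Finite.of_injective _ (Subgroup.inclusion_injective (conjAut_le_aut hP'))
  have h1 : Nat.card Q ≤ Nat.card (F.conjAut P') := by
    have hm : ∀ α : Q, MulAut.congr e ((α : F.aut hP) : MulAut P) ∈ F.conjAut P' := by
      intro α
      obtain ⟨h, hh, H⟩ := hQ α α.2
      refine mem_conjAut_iff.2 ⟨h, hh, fun y => ?_⟩
      have := H (e.symm y)
      rw [e.apply_symm_apply] at this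
      exact this
    refine Nat.card_le_card_of_injective (fun α => (⟨_, hm α⟩ : F.conjAut P')) fun a b hab => ?_
    exact Subtype.ext (Subtype.ext ((MulAut.congr e).injective (congrArg Subtype.val hab)))
  have hcard : Nat.card ((F.conjAut P).subgroupOf (F.aut hP)) = Nat.card (F.conjAut P) :=
    Nat.card_congr (Subgroup.subgroupOfEquivOfLe (conjAut_le_aut hP)).toEquiv
  have hpg : IsPGroup p ((F.conjAut P).subgroupOf (F.aut hP)) :=
    (isPGroup_conjAut P).of_equiv (Subgroup.subgroupOfEquivOfLe (conjAut_le_aut hP)).symm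
  obtain ⟨T, hT⟩ := hpg.exists_le_sylow
  have hTQ : Nat.card T = Nat.card Q := Nat.card_congr (Sylow.equiv T Q).toEquiv
  have h2 : Nat.card (F.conjAut P) ≤ Nat.card Q := by
    rw [← hcard, ← hTQ]
    exact Nat.card_le_card_of_injective _ (Subgroup.inclusion_injective hT)
  -- With `C` for centralizer and `A` for `Aut_S`: `|C(P')| |Q| ≤ |C(P')| |A(P')| ≤ |C(P)| |A(P)|`.
  -- Bounding `|A(P)|` by `|Q|` and cancelling `|Q|` gives `|C(P')| ≤ |C(P)|`; bounding `|C(P)|` by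
  -- `|C(P')|` and cancelling gives `|Q| ≤ |A(P)|`.
  have h3 := hn P' hPP'
  rw [card_normalizerIn, card_normalizerIn] at h3
  have h4 := hc P hPP'.symm
  have := finite_of_le (F.centralizerIn_le P)
  have := finite_of_le (F.centralizerIn_le P')
  have p1 : 0 < Nat.card (F.centralizerIn P') := Nat.card_pos
  have p2 : 0 < Nat.card Q := Nat.card_pos
  have e1 : Nat.card (F.centralizerIn P') ≤ Nat.card (F.centralizerIn P) :=
    Nat.le_of_mul_le_mul_right (((Nat.mul_le_mul_left _ h1).trans h3).trans
      (Nat.mul_le_mul_left _ h2)) p2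
  have e2 : Nat.card Q ≤ Nat.card (F.conjAut P) :=
    Nat.le_of_mul_le_mul_left (((Nat.mul_le_mul_left _ h1).trans h3).trans
      (Nat.mul_le_mul_right _ h4)) p1
  refine ⟨hc.of_card_le hPP'.symm e1, T, (Subgroup.eq_of_le_of_card_ge hT ?_).symm⟩
  rw [hcard]
  exact hTQ.trans_le e2

theorem exists_fullyNormalized {P : Subgroup G} (hP : P ≤ F.carrier) :
    ∃ P', F.IsConj P P' ∧ F.FullyNormalized P' := by
  have := F.finite_carrier
  let s : Set ℕ := {n | ∃ P', F.IsConj P P' ∧ Nat.card (F.normalizerIn P') = n}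
  have hne : s.Nonempty := ⟨_, P, IsConj.refl hP, rfl⟩
  have hb : BddAbove s := ⟨Nat.card F.carrier, by
    rintro _ ⟨P', -, rfl⟩
    exact Nat.card_le_card_of_injective _ (Subgroup.inclusion_injective (F.normalizerIn_le P'))⟩
  obtain ⟨P', h, h'⟩ := Nat.sSup_mem hne hb
  exact ⟨P', h, fun R hR => by rw [h']; exact le_csSup hb ⟨R, h.trans hR, rfl⟩⟩

/-- Conjugation by an isomorphism of `F`. -/
def autCongr {P P' : Subgroup G} (hP : P ≤ F.carrier) (hP' : P' ≤ F.carrier) {e : P ≃* P'}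
    (he : e.toMonoidHom ∈ F.Hom P P') : F.aut hP →* F.aut hP' :=
  ((MulAut.congr e).toMonoidHom.comp (F.aut hP).subtype).codRestrict (F.aut hP') fun α =>
    (mem_aut_iff hP').2 (F.comp_mem (F.comp_mem (F.symm_mem he) α.2.1) he)

theorem autCongr_apply {P P' : Subgroup G} (hP : P ≤ F.carrier) (hP' : P' ≤ F.carrier)
    {e : P ≃* P'} (he : e.toMonoidHom ∈ F.Hom P P') (α : F.aut hP) (x : P) :
    (autCongr hP hP' he α : MulAut P') (e x) = e ((α : MulAut P) x) := by
  change e ((α : MulAut P) (e.symm (e x))) = _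
  rw [e.symm_apply_apply]

/-- In a saturated fusion system, every `p`-subgroup of `Aut_F(P)` is conjugated into `Aut_S(P')`
by some isomorphism `P → P'` in `F` with `P'` fully centralized. -/
theorem Saturated.exists_conj [Fact p.Prime] (hF : F.Saturated) {P : Subgroup G}
    (hP : P ≤ F.carrier) (Q : Subgroup (F.aut hP)) (hQ : IsPGroup p Q) :
    ∃ (P' : Subgroup G) (e : P ≃* P'), e.toMonoidHom ∈ F.Hom P P' ∧ F.FullyCentralized P' ∧
      ∀ α ∈ Q, ∃ h ∈ F.carrier, ∀ x : P, (e ((α : MulAut P) x) : G) = h * e x * h⁻¹ := by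
  obtain ⟨P', hPP', hn⟩ := exists_fullyNormalized hP
  have hP' := hPP'.le.2
  obtain ⟨e, he⟩ := isConj_iff.1 hPP'
  obtain ⟨hc, T, hT⟩ := hF.sylow P' hP' hn
  have := finite_aut hP'
  obtain ⟨T', hT'⟩ := (hQ.map (autCongr hP hP' he)).exists_le_sylow
  obtain ⟨g, hg⟩ := MulAction.exists_smul_eq (F.aut hP') T' T
  -- The element `g` conjugating one Sylow subgroup to the other is itself an automorphism of `P'`
  -- in `F`, so it can be absorbed into the isomorphism.
  refine ⟨P', e.trans g.1, F.comp_mem he g.2.1, hc, fun α hα => ?_⟩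
  have hm : g * autCongr hP hP' he α * g⁻¹ ∈ T := by
    rw [← hg]
    exact Subgroup.smul_mem_pointwise_smul _ (MulAut.conj g) _ (hT' ⟨α, hα, rfl⟩)
  have hm' : g * autCongr hP hP' he α * g⁻¹ ∈ (T : Subgroup (F.aut hP')) := hm
  rw [hT] at hm'
  obtain ⟨h, hh, H⟩ := mem_conjAut_iff.1 hm'
  refine ⟨h, hh, fun x => ?_⟩
  have := H ((g : MulAut P') (e x))
  rw [MulEquiv.trans_apply, MulEquiv.trans_apply]
  change _ = h * ((g : MulAut P') (e x) : P') * h⁻¹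
  rw [← this, ← autCongr_apply hP hP' he]
  change _ = (((g : MulAut P') ((autCongr hP hP' he α : MulAut P')
    ((g : MulAut P')⁻¹ ((g : MulAut P') (e x)))) : P') : G)
  rw [MulAut.inv_apply_self]

end Basic

end FusionSystem

/-! ### Functoriality of `O^p` and `O^{p'}` for finite groups -/

section Residual

variable {p : ℕ} {A B : Type*} [Group A] [Group B]

/-- The preimage of a normal subgroup `N` is normal, and its index divides that of `N`, so it is
again a power of `p`. -/
theorem map_pPowerResidual_le [Fact p.Prime] (f : A →* B) :
    (pPowerResidual p A).map f ≤ pPowerResidual p B := by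
  rw [Subgroup.map_le_iff_le_comap]
  refine fun a ha => Subgroup.mem_sInf.2 ?_
  rintro N ⟨hN, k, hk⟩
  refine Subgroup.mem_sInf.1 ha (N.comap f) ⟨hN.comap f, ?_⟩
  have hd : (N.comap f).index ∣ p ^ k := by
    rw [Subgroup.index_comap, ← hk]
    exact Subgroup.relIndex_dvd_index_of_normal _ _
  obtain ⟨j, -, hj⟩ := (Nat.dvd_prime_pow Fact.out).1 hd
  exact ⟨j, hj⟩

theorem map_pPrimeResidual_le (f : A →* B) :
    (pPrimeResidual p A).map f ≤ pPrimeResidual p B := by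
  rw [Subgroup.map_le_iff_le_comap]
  refine fun a ha => Subgroup.mem_sInf.2 ?_
  rintro N ⟨hN, hk⟩
  refine Subgroup.mem_sInf.1 ha (N.comap f) ⟨hN.comap f, ?_⟩
  rw [Subgroup.index_comap]
  exact hk.coprime_dvd_left (Subgroup.relIndex_dvd_index_of_normal _ _)

end Residual

namespace FusionSystem

/-! ### Morphisms of fusion systems -/

section Morphism

variable {p : ℕ} {G H : Type*} [Group G] [Group H] {F : FusionSystem p G} {F' : FusionSystem p H}

/-- A homomorphism of groups `π : G → H` is a morphism of fusion systems from `F` to `F'` if every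
morphism `P → Q` of `F` induces a morphism `π(P) → π(Q)` of `F'`. -/
def IsMorphism (F : FusionSystem p G) (F' : FusionSystem p H) (π : G →* H) : Prop :=
  ∀ (P Q : Subgroup G) (φ : P →* Q), φ ∈ F.Hom P Q → ∃ φ' ∈ F'.Hom (P.map π) (Q.map π),
    ∀ x : P, (φ' ⟨π x, Subgroup.mem_map_of_mem π x.2⟩ : H) = π (φ x)

variable {π : G →* H}

theorem IsMorphism.map_le (h : IsMorphism F F' π) {P : Subgroup G} (hP : P ≤ F.carrier) :
    P.map π ≤ F'.carrier := by
  obtain ⟨φ, hφ, -⟩ := h _ _ _ (F.inclusion_mem le_rfl hP)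
  exact (F'.le_of_mem hφ).1

/-- Since `P → π(P)` is onto, the map induced by `α` is uniquely determined; so the chosen maps
compose as the `α` do, and `f α⁻¹` inverts `f α`. -/
theorem IsMorphism.exists_aut (h : IsMorphism F F' π) {P : Subgroup G} (hP : P ≤ F.carrier) :
    ∃ f : F.aut hP →* F'.aut (h.map_le hP), ∀ (α : F.aut hP) (x : P),
      ((f α : MulAut (P.map π)) ⟨π x, Subgroup.mem_map_of_mem π x.2⟩ : H) =
        π ((α : MulAut P) x) := by
  choose f hf hf' using fun α : F.aut hP => h _ _ _ α.2.1
  have hf'' : ∀ (α : F.aut hP) (x : P), f α ⟨π x, Subgroup.mem_map_of_mem π x.2⟩ =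
      ⟨π ((α : MulAut P) x), Subgroup.mem_map_of_mem π (Subtype.prop _)⟩ :=
    fun α x => Subtype.ext (hf' α x)
  have hinv : ∀ α : F.aut hP, (f α⁻¹).comp (f α) = MonoidHom.id _ := by
    intro α
    ext ⟨_, x, hx, rfl⟩
    have := congrArg (fun y => (f α⁻¹ y : H)) (hf'' α ⟨x, hx⟩)
    refine this.trans ((hf' α⁻¹ _).trans ?_)
    change π (((α : MulAut P)⁻¹ ((α : MulAut P) ⟨x, hx⟩) : P) : G) = π x
    rw [MulAut.inv_apply_self]
  have hinv' : ∀ α : F.aut hP, (f α).comp (f α⁻¹) = MonoidHom.id _ := by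
    intro α
    have := hinv α⁻¹
    rwa [inv_inv] at this
  refine ⟨MonoidHom.mk' (fun α => ⟨MonoidHom.toMulEquiv (f α) (f α⁻¹) (hinv α) (hinv' α),
    (mem_aut_iff _).2 (hf α)⟩) fun α β => ?_, fun α x => hf' α x⟩
  refine Subtype.ext (MulEquiv.ext ?_)
  rintro ⟨_, x, hx, rfl⟩
  refine (hf'' (α * β) ⟨x, hx⟩).trans ?_
  refine ((hf'' α ((β : MulAut P) ⟨x, hx⟩)).symm.trans ?_)
  exact congrArg (f α) (hf'' β ⟨x, hx⟩).symm

theorem IsMorphism.map_hyperfocal_le [Fact p.Prime] (h : IsMorphism F F' π) :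
    F.hyperfocal.map π ≤ F'.hyperfocal := by
  rw [Subgroup.map_le_iff_le_comap, hyperfocal, Subgroup.closure_le]
  rintro _ ⟨P, hP, α, hα, s, rfl⟩
  obtain ⟨f, hf⟩ := h.exists_aut hP
  refine Subgroup.subset_closure ⟨P.map π, h.map_le hP, f α, map_pPowerResidual_le f ⟨α, hα, rfl⟩,
    ⟨π s, Subgroup.mem_map_of_mem π s.2⟩, ?_⟩
  rw [hf, map_mul, map_inv]

end Morphism

/-! ### Saturation of the product -/

section Prod

variable {p : ℕ} {G₁ G₂ : Type*} [Group G₁] [Group G₂]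
  {F₁ : FusionSystem p G₁} {F₂ : FusionSystem p G₂}

theorem le_prod_proj (P : Subgroup (G₁ × G₂)) : P ≤ (proj₁ P).prod (proj₂ P) :=
  fun x hx => ⟨⟨x, hx, rfl⟩, ⟨x, hx, rfl⟩⟩

theorem proj₁_le {P : Subgroup (G₁ × G₂)} {A₁ : Subgroup G₁} {A₂ : Subgroup G₂}
    (h : P ≤ A₁.prod A₂) : proj₁ P ≤ A₁ := by
  rintro _ ⟨x, hx, rfl⟩
  exact (h hx).1

theorem proj₂_le {P : Subgroup (G₁ × G₂)} {A₁ : Subgroup G₁} {A₂ : Subgroup G₂}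
    (h : P ≤ A₁.prod A₂) : proj₂ P ≤ A₂ := by
  rintro _ ⟨x, hx, rfl⟩
  exact (h hx).2

/-- The product is defined by components between the exact projections of `P` and `Q`. This form
accepts components with larger sources and unrelated targets, which is how they arise in practice.
-/
theorem prod_mem {A₁ B₁ : Subgroup G₁} {A₂ B₂ : Subgroup G₂} {φ₁ : A₁ →* B₁} {φ₂ : A₂ →* B₂}
    (h₁ : φ₁ ∈ F₁.Hom A₁ B₁) (h₂ : φ₂ ∈ F₂.Hom A₂ B₂) {P Q : Subgroup (G₁ × G₂)}
    (hP : P ≤ A₁.prod A₂) (hQ : Q ≤ (F₁.prod F₂).carrier) (φ : P →* Q)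
    (h : ∀ x : P, (φ x : G₁ × G₂) = ((φ₁ ⟨x.1.1, (hP x.2).1⟩ : G₁), (φ₂ ⟨x.1.2, (hP x.2).2⟩ : G₂))) :
    φ ∈ (F₁.prod F₂).Hom P Q := by
  have m₁ : ∀ x : proj₁ P, (φ₁ ⟨x, proj₁_le hP x.2⟩ : G₁) ∈ proj₁ Q := by
    rintro ⟨_, x, hx, rfl⟩
    exact ⟨φ ⟨x, hx⟩, (φ ⟨x, hx⟩).2, congrArg Prod.fst (h ⟨x, hx⟩)⟩
  have m₂ : ∀ x : proj₂ P, (φ₂ ⟨x, proj₂_le hP x.2⟩ : G₂) ∈ proj₂ Q := by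
    rintro ⟨_, x, hx, rfl⟩
    exact ⟨φ ⟨x, hx⟩, (φ ⟨x, hx⟩).2, congrArg Prod.snd (h ⟨x, hx⟩)⟩
  exact ⟨(B₁.subtype.comp (φ₁.comp (Subgroup.inclusion (proj₁_le hP)))).codRestrict _ m₁,
    F₁.mem_of_restrict h₁ (proj₁_le hP) (proj₁_le hQ) _ fun x => rfl,
    (B₂.subtype.comp (φ₂.comp (Subgroup.inclusion (proj₂_le hP)))).codRestrict _ m₂,
    F₂.mem_of_restrict h₂ (proj₂_le hP) (proj₂_le hQ) _ fun x => rfl, h⟩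

theorem isMorphism_fst (F₁ : FusionSystem p G₁) (F₂ : FusionSystem p G₂) :
    IsMorphism (F₁.prod F₂) F₁ (MonoidHom.fst G₁ G₂) := by
  rintro P Q φ ⟨φ₁, h₁, φ₂, h₂, h⟩
  exact ⟨φ₁, h₁, fun x => (congrArg Prod.fst (h x)).symm⟩

theorem isMorphism_snd (F₁ : FusionSystem p G₁) (F₂ : FusionSystem p G₂) :
    IsMorphism (F₁.prod F₂) F₂ (MonoidHom.snd G₁ G₂) := by
  rintro P Q φ ⟨φ₁, h₁, φ₂, h₂, h⟩
  exact ⟨φ₂, h₂, fun x => (congrArg Prod.snd (h x)).symm⟩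

/-- The restriction of `(φ₁, φ₂) : A₁ × A₂ → B₁ × B₂` to a subgroup `P ≤ A₁ × A₂`. -/
def pairHom {P : Subgroup (G₁ × G₂)} {A₁ B₁ : Subgroup G₁} {A₂ B₂ : Subgroup G₂}
    (hP : P ≤ A₁.prod A₂) (φ₁ : A₁ →* B₁) (φ₂ : A₂ →* B₂) : P →* B₁.prod B₂ :=
  MonoidHom.mk' (fun x => ⟨((φ₁ ⟨x.1.1, (hP x.2).1⟩ : G₁), (φ₂ ⟨x.1.2, (hP x.2).2⟩ : G₂)),
    (φ₁ _).2, (φ₂ _).2⟩) fun x y => Subtype.ext (Prod.ext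
      (congrArg Subtype.val (φ₁.map_mul ⟨x.1.1, (hP x.2).1⟩ ⟨y.1.1, (hP y.2).1⟩))
      (congrArg Subtype.val (φ₂.map_mul ⟨x.1.2, (hP x.2).2⟩ ⟨y.1.2, (hP y.2).2⟩)))

theorem pairHom_mem {A₁ B₁ : Subgroup G₁} {A₂ B₂ : Subgroup G₂} {φ₁ : A₁ →* B₁} {φ₂ : A₂ →* B₂}
    (h₁ : φ₁ ∈ F₁.Hom A₁ B₁) (h₂ : φ₂ ∈ F₂.Hom A₂ B₂) {P : Subgroup (G₁ × G₂)}
    (hP : P ≤ A₁.prod A₂) : pairHom hP φ₁ φ₂ ∈ (F₁.prod F₂).Hom P (B₁.prod B₂) :=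
  prod_mem h₁ h₂ hP (Subgroup.prod_mono (F₁.le_of_mem h₁).2 (F₂.le_of_mem h₂).2) _ fun _ => rfl

/-- Take for `P'` the image of `P` under `(e₁, e₂)`; its projections fill `B₁` and `B₂` because each
`eᵢ` is onto. -/
theorem exists_equiv_prod {P : Subgroup (G₁ × G₂)} {B₁ : Subgroup G₁} {B₂ : Subgroup G₂}
    {e₁ : proj₁ P ≃* B₁} {e₂ : proj₂ P ≃* B₂} (h₁ : e₁.toMonoidHom ∈ F₁.Hom (proj₁ P) B₁)
    (h₂ : e₂.toMonoidHom ∈ F₂.Hom (proj₂ P) B₂) :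
    ∃ (P' : Subgroup (G₁ × G₂)) (e : P ≃* P'), e.toMonoidHom ∈ (F₁.prod F₂).Hom P P' ∧
      proj₁ P' = B₁ ∧ proj₂ P' = B₂ ∧ ∀ x : P, (e x : G₁ × G₂) =
        ((e₁ ⟨x.1.1, x.1, x.2, rfl⟩ : G₁), (e₂ ⟨x.1.2, x.1, x.2, rfl⟩ : G₂)) := by
  have h := pairHom_mem h₁ h₂ (le_prod_proj P)
  refine ⟨_, equivImage _ ((F₁.prod F₂).injective_of_mem h), equivImage_mem h,
    le_antisymm (proj₁_le (image_le _)) fun y hy => ?_,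
    le_antisymm (proj₂_le (image_le _)) fun y hy => ?_, fun x => rfl⟩
  · obtain ⟨⟨_, x, hx, rfl⟩, hxy⟩ := e₁.surjective ⟨y, hy⟩
    exact ⟨_, mem_image.2 ⟨⟨x, hx⟩, rfl⟩, congrArg Subtype.val hxy⟩
  · obtain ⟨⟨_, x, hx, rfl⟩, hxy⟩ := e₂.surjective ⟨y, hy⟩
    exact ⟨_, mem_image.2 ⟨⟨x, hx⟩, rfl⟩, congrArg Subtype.val hxy⟩

/-- Commuting with `P` is a condition on each coordinate separately, so the centralizer is a product
even when `P` is not. The analogue for normalizers fails, which is why the argument runs through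
centralizers. -/
theorem card_centralizerIn_prod (P : Subgroup (G₁ × G₂)) :
    Nat.card ((F₁.prod F₂).centralizerIn P) =
      Nat.card (F₁.centralizerIn (proj₁ P)) * Nat.card (F₂.centralizerIn (proj₂ P)) := by
  have : (F₁.prod F₂).centralizerIn P =
      (F₁.centralizerIn (proj₁ P)).prod (F₂.centralizerIn (proj₂ P)) := by
    ext x
    rw [Subgroup.mem_prod, mem_centralizerIn, mem_centralizerIn, mem_centralizerIn]
    constructor
    · rintro ⟨h, h'⟩
      refine ⟨⟨h.1, ?_⟩, ⟨h.2, ?_⟩⟩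
      · rintro _ ⟨y, hy, rfl⟩
        exact congrArg Prod.fst (h' y hy)
      · rintro _ ⟨y, hy, rfl⟩
        exact congrArg Prod.snd (h' y hy)
    · rintro ⟨h, h'⟩
      exact ⟨⟨h.1, h'.1⟩, fun y hy => Prod.ext (h.2 _ ⟨y, hy, rfl⟩) (h'.2 _ ⟨y, hy, rfl⟩)⟩
  rw [this, Nat.card_congr (Subgroup.prodEquiv _ _).toEquiv, Nat.card_prod]

theorem IsMorphism.isConj {G H : Type*} [Group G] [Group H] {F : FusionSystem p G}
    {F' : FusionSystem p H} {π : G →* H} (h : IsMorphism F F' π) {P Q : Subgroup G}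
    (hc : F.IsConj P Q) : F'.IsConj (P.map π) (Q.map π) := by
  obtain ⟨e, he⟩ := isConj_iff.1 hc
  obtain ⟨φ, hφ, H⟩ := h _ _ _ he
  refine isConj_iff.2 ⟨MulEquiv.ofBijective φ ⟨F'.injective_of_mem hφ, ?_⟩, hφ⟩
  rintro ⟨_, y, hy, rfl⟩
  refine ⟨⟨_, Subgroup.mem_map_of_mem π (e.symm ⟨y, hy⟩).2⟩, Subtype.ext ?_⟩
  refine (H _).trans ?_
  change π (e (e.symm ⟨y, hy⟩)) = π y
  rw [e.apply_symm_apply]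

theorem FullyCentralized.prod {P : Subgroup (G₁ × G₂)} (h₁ : F₁.FullyCentralized (proj₁ P))
    (h₂ : F₂.FullyCentralized (proj₂ P)) : (F₁.prod F₂).FullyCentralized P := by
  intro P' h
  rw [card_centralizerIn_prod, card_centralizerIn_prod]
  exact Nat.mul_le_mul (h₁ _ ((isMorphism_fst F₁ F₂).isConj h))
    (h₂ _ ((isMorphism_snd F₁ F₂).isConj h))

/-- Moving `P` by `(e₁, id)` leaves the second factor of the centralizer order unchanged, so it
cancels. -/
theorem FullyCentralized.fst {P : Subgroup (G₁ × G₂)} (hP : P ≤ (F₁.prod F₂).carrier)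
    (h : (F₁.prod F₂).FullyCentralized P) : F₁.FullyCentralized (proj₁ P) := by
  intro Q hQ
  obtain ⟨e₁, he₁⟩ := isConj_iff.1 hQ
  have he₂ : (MulEquiv.refl (proj₂ P)).toMonoidHom ∈ F₂.Hom _ _ :=
    F₂.inclusion_mem le_rfl (proj₂_le hP)
  obtain ⟨P', e, he, e1, e2, -⟩ := exists_equiv_prod he₁ he₂
  have := h P' (isConj_iff.2 ⟨e, he⟩)
  rw [card_centralizerIn_prod, card_centralizerIn_prod, e1, e2] at this
  have := finite_of_le (F₂.centralizerIn_le (proj₂ P))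
  exact Nat.le_of_mul_le_mul_right ‹_› Nat.card_pos

theorem FullyCentralized.snd {P : Subgroup (G₁ × G₂)} (hP : P ≤ (F₁.prod F₂).carrier)
    (h : (F₁.prod F₂).FullyCentralized P) : F₂.FullyCentralized (proj₂ P) := by
  intro Q hQ
  obtain ⟨e₂, he₂⟩ := isConj_iff.1 hQ
  have he₁ : (MulEquiv.refl (proj₁ P)).toMonoidHom ∈ F₁.Hom _ _ :=
    F₁.inclusion_mem le_rfl (proj₁_le hP)
  obtain ⟨P', e, he, e1, e2, -⟩ := exists_equiv_prod he₁ he₂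
  have := h P' (isConj_iff.2 ⟨e, he⟩)
  rw [card_centralizerIn_prod, card_centralizerIn_prod, e1, e2] at this
  have := finite_of_le (F₁.centralizerIn_le (proj₁ P))
  exact Nat.le_of_mul_le_mul_left ‹_› Nat.card_pos

/-- A fusion system morphism `φ : P → S` projects to a morphism `φ' : π(P) → S'`, whose image is
the projection of the image of `φ`, and whose extension subgroup contains the projection of the
extension subgroup of `φ`. -/
theorem IsMorphism.exists_extensionSubgroup_le {G H : Type*} [Group G] [Group H]
    {F : FusionSystem p G} {F' : FusionSystem p H} {π : G →* H} (h : IsMorphism F F' π)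
    {P : Subgroup G} {φ : P →* F.carrier} (hφ : φ ∈ F.Hom P F.carrier) :
    ∃ φ' ∈ F'.Hom (P.map π) F'.carrier, image φ' = (image φ).map π ∧
      (F.extensionSubgroup φ).map π ≤ F'.extensionSubgroup φ' ∧
      ∀ x : P, (φ' ⟨π x, Subgroup.mem_map_of_mem π x.2⟩ : H) = π (φ x) := by
  obtain ⟨φ', hφ', H⟩ := h _ _ _ hφ
  have hS := h.map_le (le_refl F.carrier)
  have him : image ((Subgroup.inclusion hS).comp φ') = (image φ).map π := by
    ext y
    rw [mem_image]
    constructor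
    · rintro ⟨⟨_, x, hx, rfl⟩, rfl⟩
      exact ⟨_, mem_image.2 ⟨⟨x, hx⟩, rfl⟩, (H ⟨x, hx⟩).symm⟩
    · rintro ⟨_, hy, rfl⟩
      obtain ⟨x, rfl⟩ := mem_image.1 hy
      exact ⟨_, H x⟩
  have hnorm : ∀ {R : Subgroup G} {g : G}, g ∈ F.normalizerIn R → π g ∈ F'.normalizerIn (R.map π) :=
    fun {R g} hg => ⟨hS ⟨g, hg.1, rfl⟩, Subgroup.le_normalizer_map π ⟨g, hg.2, rfl⟩⟩
  refine ⟨_, F'.comp_mem hφ' (F'.inclusion_mem hS le_rfl), him, ?_, H⟩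
  rintro _ ⟨g, ⟨hg, k, hk, hgk⟩, rfl⟩
  refine ⟨hnorm hg, π k, ?_, ?_⟩
  · rw [him]
    exact hnorm hk
  · rintro ⟨_, x, hx, rfl⟩ y hy
    have hz : g * x * g⁻¹ ∈ P := (Subgroup.mem_normalizer_iff.1 hg.2 x).1 hx
    have e : y = ⟨π (g * x * g⁻¹), Subgroup.mem_map_of_mem π hz⟩ := Subtype.ext (hy.trans (by
      change π g * π x * (π g)⁻¹ = π (g * x * g⁻¹)
      rw [map_mul, map_mul, map_inv]))
    rw [e]
    refine (H ⟨_, hz⟩).trans ?_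
    rw [hgk ⟨x, hx⟩ ⟨_, hz⟩ rfl, map_mul, map_mul, map_inv]
    exact congrArg (fun t => π k * t * (π k)⁻¹) (H ⟨x, hx⟩).symm

/-- A product of saturated fusion systems is saturated. -/
theorem Saturated.prod [Fact p.Prime] (hF₁ : F₁.Saturated) (hF₂ : F₂.Saturated) :
    (F₁.prod F₂).Saturated where
  sylow P hP hn := by
    -- The projections of `P` need not be fully normalized, so the Sylow axiom cannot be applied to
    -- them directly; the images of `Q` are only known to be `p`-subgroups, which is all that
    -- `exists_conj` requires.
    obtain ⟨Q⟩ : Nonempty (Sylow p ((F₁.prod F₂).aut hP)) := inferInstance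
    obtain ⟨f₁, hf₁⟩ := (isMorphism_fst F₁ F₂).exists_aut hP
    obtain ⟨f₂, hf₂⟩ := (isMorphism_snd F₁ F₂).exists_aut hP
    obtain ⟨P₁, e₁, he₁, hc₁, hQ₁⟩ := hF₁.exists_conj _ (Q.1.map f₁) (Q.2.map f₁)
    obtain ⟨P₂, e₂, he₂, hc₂, hQ₂⟩ := hF₂.exists_conj _ (Q.1.map f₂) (Q.2.map f₂)
    obtain ⟨P', e, he, rfl, rfl, H⟩ := exists_equiv_prod he₁ he₂
    refine hn.sylow_of_conj hP he (hc₁.prod hc₂) Q fun α hα => ?_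
    obtain ⟨k₁, hk₁, H₁⟩ := hQ₁ _ ⟨α, hα, rfl⟩
    obtain ⟨k₂, hk₂, H₂⟩ := hQ₂ _ ⟨α, hα, rfl⟩
    refine ⟨(k₁, k₂), ⟨hk₁, hk₂⟩, fun x => ?_⟩
    rw [H, H x]
    refine Prod.ext ?_ ?_
    · refine Eq.trans ?_ (H₁ ⟨x.1.1, x.1, x.2, rfl⟩)
      exact congrArg (fun t => (e₁ t : G₁)) (Subtype.ext (hf₁ α x).symm)
    · refine Eq.trans ?_ (H₂ ⟨x.1.2, x.1, x.2, rfl⟩)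
      exact congrArg (fun t => (e₂ t : G₂)) (Subtype.ext (hf₂ α x).symm)
  extension P hP φ hφ hc := by
    obtain ⟨φ₁, hφ₁, i₁, l₁, H₁⟩ := (isMorphism_fst F₁ F₂).exists_extensionSubgroup_le hφ
    obtain ⟨φ₂, hφ₂, i₂, l₂, H₂⟩ := (isMorphism_snd F₁ F₂).exists_extensionSubgroup_le hφ
    obtain ⟨ψ₁, hψ₁, E₁⟩ := hF₁.extension _ (proj₁_le hP) φ₁ hφ₁ (i₁ ▸ hc.fst (image_le _))
    obtain ⟨ψ₂, hψ₂, E₂⟩ := hF₂.extension _ (proj₂_le hP) φ₂ hφ₂ (i₂ ▸ hc.snd (image_le _))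
    refine ⟨_, pairHom_mem hψ₁ hψ₂ ((le_prod_proj _).trans (Subgroup.prod_mono l₁ l₂)),
      MonoidHom.ext fun x => Subtype.ext (Prod.ext ?_ ?_)⟩
    · refine Eq.trans ?_ (H₁ x)
      exact congrArg Subtype.val (DFunLike.congr_fun E₁ ⟨x.1.1, x.1, x.2, rfl⟩)
    · refine Eq.trans ?_ (H₂ x)
      exact congrArg Subtype.val (DFunLike.congr_fun E₂ ⟨x.1.2, x.1, x.2, rfl⟩)

end Prod

end FusionSystem

namespace FusionSystem

/-! ### Subgroups `P × T` and maps `(φ, id)`; taking `e` to be the identity or the swap covers both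
factors -/

section Cylinder

variable {G H K : Type*} [Group G] [Group H] [Group K]

/-- The subgroup `P × T` of `G ≅ H × K`. -/
def cylinder (e : G ≃* H × K) (P : Subgroup H) (T : Subgroup K) : Subgroup G :=
  (P.prod T).comap e.toMonoidHom

theorem mem_cylinder {e : G ≃* H × K} {P : Subgroup H} {T : Subgroup K} {x : G} :
    x ∈ cylinder e P T ↔ (e x).1 ∈ P ∧ (e x).2 ∈ T :=
  Iff.rfl

theorem symm_mem_cylinder {e : G ≃* H × K} {P : Subgroup H} {T : Subgroup K} {a : H} {b : K}
    (ha : a ∈ P) (hb : b ∈ T) : e.symm (a, b) ∈ cylinder e P T := by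
  rw [mem_cylinder, e.apply_symm_apply]
  exact ⟨ha, hb⟩

theorem symm_mul_symm (e : G ≃* H × K) (x : G) :
    e.symm ((e x).1, 1) * e.symm (1, (e x).2) = x := by
  rw [← map_mul, Prod.mk_mul_mk, mul_one, one_mul]
  exact e.symm_apply_apply x

theorem card_cylinder (e : G ≃* H × K) (P : Subgroup H) (T : Subgroup K) :
    Nat.card (cylinder e P T) = Nat.card P * Nat.card T := by
  rw [← Nat.card_prod, ← Nat.card_congr (Subgroup.prodEquiv P T).toEquiv]
  exact Nat.card_congr (e.toEquiv.subtypeEquiv fun _ => Iff.rfl)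

/-- The projection `P × T → P`. -/
def cylinderFst (e : G ≃* H × K) {P : Subgroup H} {T : Subgroup K} : cylinder e P T →* P :=
  MonoidHom.mk' (fun x => ⟨(e x).1, (mem_cylinder.1 x.2).1⟩) fun x y =>
    Subtype.ext (congrArg Prod.fst (map_mul e (x : G) y))

/-- The element of `P × T` with given components. -/
def cylinderMk (e : G ≃* H × K) {P : Subgroup H} {T : Subgroup K} (a : P) (b : T) :
    cylinder e P T :=
  ⟨e.symm (a, b), symm_mem_cylinder a.2 b.2⟩

theorem apply_cylinderMk (e : G ≃* H × K) {P : Subgroup H} {T : Subgroup K} (a : P) (b : T) :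
    e (cylinderMk e a b) = ((a : H), (b : K)) :=
  e.apply_symm_apply _

theorem cylinderFst_cylinderMk (e : G ≃* H × K) {P : Subgroup H} {T : Subgroup K} (a : P) (b : T) :
    cylinderFst e (cylinderMk e a b) = a :=
  Subtype.ext (congrArg Prod.fst (apply_cylinderMk e a b))

/-- The homomorphism `(φ, id) : P × T → Q × T`. -/
def cylinderMap (e : G ≃* H × K) {P Q : Subgroup H} (φ : P →* Q) (T : Subgroup K) :
    cylinder e P T →* cylinder e Q T :=
  MonoidHom.mk' (fun x => cylinderMk e (φ (cylinderFst e x)) ⟨(e x).2, (mem_cylinder.1 x.2).2⟩)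
    fun x y => Subtype.ext <| e.injective <| by
      rw [Subgroup.coe_mul (cylinder e Q T), map_mul e, apply_cylinderMk, apply_cylinderMk,
        apply_cylinderMk, map_mul (cylinderFst e), map_mul]
      exact Prod.ext rfl (congrArg Prod.snd (map_mul e (x : G) y) :)

theorem apply_cylinderMap (e : G ≃* H × K) {P Q : Subgroup H} (φ : P →* Q) (T : Subgroup K)
    (x : cylinder e P T) : e (cylinderMap e φ T x) = ((φ (cylinderFst e x) : H), (e x).2) :=
  apply_cylinderMk _ _ _

theorem cylinderMap_comp (e : G ≃* H × K) {P Q R : Subgroup H} (ψ : Q →* R) (φ : P →* Q)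
    (T : Subgroup K) :
    cylinderMap e (ψ.comp φ) T = (cylinderMap e ψ T).comp (cylinderMap e φ T) := by
  refine MonoidHom.ext fun x => Subtype.ext (e.injective ?_)
  have h : cylinderFst e (cylinderMap e φ T x) = φ (cylinderFst e x) :=
    Subtype.ext (congrArg Prod.fst (apply_cylinderMap e φ T x))
  rw [MonoidHom.comp_apply, apply_cylinderMap, apply_cylinderMap, h, apply_cylinderMap]
  rfl

theorem cylinderMap_id (e : G ≃* H × K) (P : Subgroup H) (T : Subgroup K) :
    cylinderMap e (MonoidHom.id P) T = MonoidHom.id _ :=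
  MonoidHom.ext fun x => Subtype.ext (e.injective (apply_cylinderMap e _ T x))

/-- The isomorphism `(ε, id) : P × T → Q × T`. -/
def cylinderEquiv (e : G ≃* H × K) {P Q : Subgroup H} (ε : P ≃* Q) (T : Subgroup K) :
    cylinder e P T ≃* cylinder e Q T :=
  MonoidHom.toMulEquiv (cylinderMap e ε.toMonoidHom T) (cylinderMap e ε.symm.toMonoidHom T)
    (by
      rw [← cylinderMap_comp, ← cylinderMap_id]
      congr 1
      exact MonoidHom.ext ε.symm_apply_apply)
    (by
      rw [← cylinderMap_comp, ← cylinderMap_id]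
      congr 1
      exact MonoidHom.ext ε.apply_symm_apply)

theorem cylinderMap_injective {e : G ≃* H × K} {P Q : Subgroup H} {φ : P →* Q} {T : Subgroup K}
    (h : Function.Injective (cylinderMap e φ T)) : Function.Injective φ := by
  intro a b hab
  have : cylinderMap e φ T (cylinderMk e a 1) = cylinderMap e φ T (cylinderMk e b 1) := by
    refine Subtype.ext (e.injective ?_)
    rw [apply_cylinderMap, apply_cylinderMap, cylinderFst_cylinderMk, cylinderFst_cylinderMk, hab,
      apply_cylinderMk, apply_cylinderMk]
  rw [← cylinderFst_cylinderMk e a (1 : T), h this, cylinderFst_cylinderMk]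

/-- The homomorphism `Aut(P) → Aut(P × T)` sending `α` to `(α, id)`. -/
def cylinderAut (e : G ≃* H × K) (P : Subgroup H) (T : Subgroup K) :
    MulAut P →* MulAut (cylinder e P T) :=
  MonoidHom.mk' (fun α => cylinderEquiv e α T) fun α β => MulEquiv.ext fun x =>
    DFunLike.congr_fun (cylinderMap_comp e (MulEquiv.toMonoidHom α) (MulEquiv.toMonoidHom β) T) x

end Cylinder

/-! ### The factor of a subsystem, and its saturation -/

section Factor

variable {p : ℕ} {G H K : Type*} [Group G] [Group H] [Group K]

/-- The subgroup `T₂` of `K` consisting of all `b` such that `(1, b)` lies in the `p`-group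
of `D`. -/
def sndCarrier (D : FusionSystem p G) (e : G ≃* H × K) : Subgroup K :=
  D.carrier.comap (e.symm.toMonoidHom.comp (MonoidHom.inr H K))

/-- The subgroup `T₁` of `H` consisting of all `a` such that `(a, 1)` lies in the `p`-group
of `D`. -/
def fstCarrier (D : FusionSystem p G) (e : G ≃* H × K) : Subgroup H :=
  D.carrier.comap (e.symm.toMonoidHom.comp (MonoidHom.inl H K))

theorem cylinder_le {D : FusionSystem p G} {e : G ≃* H × K} {P : Subgroup H}
    (hP : P ≤ D.fstCarrier e) : cylinder e P (D.sndCarrier e) ≤ D.carrier := by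
  intro x hx
  rw [← symm_mul_symm e x]
  exact mul_mem (hP hx.1) hx.2

theorem le_fstCarrier {D : FusionSystem p G} {e : G ≃* H × K} {P : Subgroup H} {T : Subgroup K}
    (h : cylinder e P T ≤ D.carrier) : P ≤ D.fstCarrier e :=
  fun _ ha => h (symm_mem_cylinder ha (one_mem _))

/-- For a fusion system `D` over a subgroup of `H × K`, the fusion system whose morphisms are
those `φ : P → Q` for which `(φ, id) : P × T₂ → Q × T₂` is a morphism of `D`. -/
noncomputable def factor (D : FusionSystem p G) (e : G ≃* H × K) : FusionSystem p H where
  carrier := D.fstCarrier e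
  Hom P Q := {φ | cylinderMap e φ (D.sndCarrier e) ∈ D.Hom _ _}
  finite_carrier := by
    have := D.finite_carrier
    refine Finite.of_injective (fun a : D.fstCarrier e => (⟨_, a.2⟩ : D.carrier)) fun a b hab => ?_
    exact Subtype.ext (congrArg Prod.fst (e.symm.injective (Subtype.mk.inj hab)))
  isPGroup_carrier := D.isPGroup_carrier.comap_of_injective _
    (e.symm.injective.comp fun a b hab => congrArg Prod.fst hab)
  le_of_mem h := ⟨le_fstCarrier (D.le_of_mem h).1, le_fstCarrier (D.le_of_mem h).2⟩
  injective_of_mem h := cylinderMap_injective (D.injective_of_mem h)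
  comp_mem := by
    intro P Q R φ ψ h h'
    change cylinderMap e (ψ.comp φ) _ ∈ D.Hom _ _
    rw [cylinderMap_comp]
    exact D.comp_mem h h'
  conj_mem := by
    rintro P Q hP hQ c ⟨g, hg, hc⟩
    -- The conjugating element is `(g, 1)`, which acts trivially on the second coordinate.
    refine D.conj_mem (cylinder_le hP) (cylinder_le hQ) _ ⟨_, hg, fun x => e.injective ?_⟩
    rw [apply_cylinderMap, hc]
    change _ = e (e.symm (g, 1) * x * (e.symm (g, 1))⁻¹)
    rw [map_mul, map_mul, map_inv, e.apply_symm_apply]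
    exact Prod.ext rfl (by simp)
  exists_factor := by
    intro P Q φ hφ
    have hinj := cylinderMap_injective (D.injective_of_mem hφ)
    have hχ : cylinderMap e (equivImage φ hinj).toMonoidHom (D.sndCarrier e) ∈ D.Hom _ _ := by
      refine D.mem_of_restrict hφ le_rfl ?_ _ fun x => rfl
      exact cylinder_le ((image_le φ).trans (le_fstCarrier (D.le_of_mem hφ).2))
    refine ⟨image φ, image_le φ, _, hχ, (equivImage φ hinj).symm.toMonoidHom,
      D.symm_mem (e := cylinderEquiv e (equivImage φ hinj) _) hχ,
      MonoidHom.ext (equivImage φ hinj).symm_apply_apply,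
      MonoidHom.ext (equivImage φ hinj).apply_symm_apply, MonoidHom.ext fun x => rfl⟩

variable {D : FusionSystem p G} {e : G ≃* H × K}

theorem mem_factor_of {P Q : Subgroup H} {R : Subgroup G} {φ : P →* Q}
    {ψ : cylinder e P (D.sndCarrier e) →* R} (hψ : ψ ∈ D.Hom _ R) (hQ : Q ≤ D.fstCarrier e)
    (h : ∀ x : cylinder e P (D.sndCarrier e), e (ψ x) = ((φ (cylinderFst e x) : H), (e x).2)) :
    φ ∈ (D.factor e).Hom P Q :=
  D.mem_of_restrict hψ le_rfl (cylinder_le hQ) _ fun x => e.injective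
    ((apply_cylinderMap _ _ _ _).trans (h x).symm)

/-- The fusion system `D` is over a subgroup `T₁ × T₂` of `H × K`, and its morphisms preserve the
two factors. -/
structure Splits (D : FusionSystem p G) (e : G ≃* H × K) : Prop where
  fst_mem : ∀ x ∈ D.carrier, (e x).1 ∈ D.fstCarrier e
  fst_eq_one : ∀ {P Q : Subgroup G} {φ : P →* Q}, φ ∈ D.Hom P Q →
    ∀ x : P, (e x).1 = 1 → (e (φ x)).1 = 1
  snd_eq_one : ∀ {P Q : Subgroup G} {φ : P →* Q}, φ ∈ D.Hom P Q →
    ∀ x : P, (e x).2 = 1 → (e (φ x)).2 = 1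

namespace Splits

theorem snd_mem (hD : D.Splits e) {x : G} (hx : x ∈ D.carrier) : (e x).2 ∈ D.sndCarrier e := by
  change e.symm (1, (e x).2) ∈ D.carrier
  have h : e.symm (1, (e x).2) = (e.symm ((e x).1, 1))⁻¹ * x := by
    rw [eq_inv_mul_iff_mul_eq, symm_mul_symm e x]
  have h1 : e.symm ((e x).1, 1) ∈ D.carrier := hD.fst_mem x hx
  rw [h]
  exact mul_mem (inv_mem h1) hx

/-- A morphism of `D` on `P × T₂` which is the identity on `T₂` has the form `(φ, id)`. -/
theorem exists_mem_factor (hD : D.Splits e) {P : Subgroup H} {R : Subgroup G}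
    {ψ : cylinder e P (D.sndCarrier e) →* R} (hψ : ψ ∈ D.Hom _ R)
    (h : ∀ x : cylinder e P (D.sndCarrier e), (e x).1 = 1 → (ψ x : G) = x) :
    ∃ φ ∈ (D.factor e).Hom P (D.fstCarrier e), ∀ x : cylinder e P (D.sndCarrier e),
      e (ψ x) = ((φ (cylinderFst e x) : H), (e x).2) := by
  let φ : P →* D.fstCarrier e := MonoidHom.mk' (fun a => ⟨(e (ψ (cylinderMk e a 1))).1,
      hD.fst_mem _ ((D.le_of_mem hψ).2 (ψ _).2)⟩) fun a b => Subtype.ext <| by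
    have : (cylinderMk e (a * b) 1 : cylinder e P (D.sndCarrier e)) =
        cylinderMk e a 1 * cylinderMk e b 1 := Subtype.ext <| e.injective <| by
      rw [Subgroup.coe_mul, map_mul, apply_cylinderMk, apply_cylinderMk, apply_cylinderMk,
        Prod.mk_mul_mk, ← Subgroup.coe_mul, ← Subgroup.coe_mul, mul_one]
    change (e (ψ (cylinderMk e (a * b) 1))).1 = _
    rw [this, map_mul, Subgroup.coe_mul, map_mul]
    rfl
  have hφ : ∀ x : cylinder e P (D.sndCarrier e),
      e (ψ x) = ((φ (cylinderFst e x) : H), (e x).2) := by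
    intro x
    have hx : x = cylinderMk e (cylinderFst e x) 1 *
        cylinderMk e 1 ⟨(e x).2, (mem_cylinder.1 x.2).2⟩ :=
      Subtype.ext (symm_mul_symm e (x : G)).symm
    have h1 := hD.snd_eq_one hψ (cylinderMk e (cylinderFst e x) 1) (by rw [apply_cylinderMk]; rfl)
    have h2 := h (cylinderMk e 1 ⟨(e x).2, (mem_cylinder.1 x.2).2⟩) (by rw [apply_cylinderMk]; rfl)
    have h3 : e (ψ x) = e (ψ (cylinderMk e (cylinderFst e x) 1)) * (1, (e x).2) := by
      conv_lhs => rw [hx]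
      rw [map_mul, Subgroup.coe_mul, map_mul, h2, apply_cylinderMk]
      rfl
    rw [h3]
    refine Prod.ext (mul_one _) ?_
    rw [Prod.snd_mul, h1, one_mul]
  exact ⟨φ, mem_factor_of hψ le_rfl hφ, hφ⟩

/-- Since `D` preserves the factors, `ω` restricts to an automorphism of `1 × T₂`. The inverse of
that automorphism extends to the whole `p`-group of `D` by the extension axiom, and the extension is
`β`. -/
theorem exists_untwist (hD : D.Splits e) (hs : D.Saturated) {P : Subgroup H} {R : Subgroup G}
    {ω : cylinder e P (D.sndCarrier e) →* R} (hω : ω ∈ D.Hom _ R) :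
    ∃ β ∈ D.Hom D.carrier D.carrier, ∀ x : cylinder e P (D.sndCarrier e), (e x).1 = 1 →
      (β ⟨ω x, (D.le_of_mem hω).2 (ω x).2⟩ : G) = x := by
  have hR := (D.le_of_mem hω).2
  set C := cylinder e ⊥ (D.sndCarrier e)
  have hCS : C ≤ D.carrier := cylinder_le bot_le
  have hmem : ∀ x, x ∈ C ↔ x ∈ D.carrier ∧ (e x).1 = 1 := fun x =>
    ⟨fun hx => ⟨hCS hx, Subgroup.mem_bot.1 hx.1⟩, fun hx =>
      ⟨Subgroup.mem_bot.2 hx.2, hD.snd_mem hx.1⟩⟩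
  have hCP : C ≤ cylinder e P (D.sndCarrier e) := fun x hx => mem_cylinder.2 ⟨by
    rw [((hmem x).1 hx).2]
    exact one_mem P, hx.2⟩
  have := finite_of_le hCS
  have hm : ∀ x : C, (ω ⟨x, hCP x.2⟩ : G) ∈ C := fun x =>
    (hmem _).2 ⟨hR (ω _).2, hD.fst_eq_one hω _ ((hmem _).1 x.2).2⟩
  let ω₀ : C →* C := (R.subtype.comp (ω.comp (Subgroup.inclusion hCP))).codRestrict C hm
  have hω₀ : ω₀ ∈ D.Hom C C := D.mem_of_restrict hω hCP hCS _ fun _ => rfl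
  let ε : C ≃* C := MulEquiv.ofBijective ω₀
    (Finite.injective_iff_bijective.1 (D.injective_of_mem hω₀))
  have hε : ε.symm.toMonoidHom ∈ D.Hom C C := D.symm_mem (e := ε) hω₀
  have hφ := D.comp_mem hε (D.inclusion_mem hCS le_rfl)
  set φ := (Subgroup.inclusion hCS).comp ε.symm.toMonoidHom
  have him : image φ = C := by
    ext y
    rw [mem_image]
    constructor
    · rintro ⟨x, rfl⟩
      exact (ε.symm x).2
    · intro hy
      refine ⟨ε ⟨y, hy⟩, ?_⟩
      change ((ε.symm (ε ⟨y, hy⟩) : C) : G) = y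
      rw [ε.symm_apply_apply]
  -- `C = 1 × T₂` is conjugate only to itself: a conjugate lies in `C` since first coordinates equal
  -- to `1` are preserved, and it has the same order.
  have hfc : D.FullyCentralized (image φ) := by
    rw [him]
    intro P' hP'
    obtain ⟨e', he'⟩ := isConj_iff.1 hP'
    have hle : P' ≤ C := fun y hy => by
      have := hD.fst_eq_one he' (e'.symm ⟨y, hy⟩) ((hmem _).1 (e'.symm ⟨y, hy⟩).2).2
      change (e (e' (e'.symm ⟨y, hy⟩) : P')).1 = 1 at this
      rw [e'.apply_symm_apply] at this
      exact (hmem _).2 ⟨hP'.le.2 hy, this⟩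
    rw [Subgroup.eq_of_le_of_card_ge hle (Nat.card_congr e'.toEquiv).le]
  obtain ⟨ψ, hψ, hψφ⟩ := hs.extension C hCS φ hφ hfc
  -- An element `(a, b)` acts on `1 × T₂` as `(1, b)` does, and `(1, b)` lies in `C`, so `φ` carries
  -- this action to conjugation by `φ(1, b)`.
  have hN : D.carrier ≤ D.extensionSubgroup φ := by
    intro g hg
    have hc : e.symm (1, (e g).2) ∈ C := symm_mem_cylinder (one_mem _) (hD.snd_mem hg)
    refine ⟨⟨hg, Subgroup.mem_normalizer_iff.2 fun x => ?_⟩, φ ⟨_, hc⟩,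
      ⟨(φ _).2, Subgroup.le_normalizer (mem_image.2 ⟨_, rfl⟩)⟩, fun x y hxy => ?_⟩
    · rw [hmem, hmem, map_mul, map_mul, map_inv]
      refine and_congr ?_ ?_
      · rw [Subgroup.mul_mem_cancel_right _ (inv_mem hg), Subgroup.mul_mem_cancel_left _ hg]
      · exact (conj_eq_one_iff).symm
    · have hy : y = ⟨_, hc⟩ * x * ⟨_, hc⟩⁻¹ := by
        refine Subtype.ext (e.injective ?_)
        change _ = e (e.symm (1, (e g).2) * x * (e.symm (1, (e g).2))⁻¹)
        rw [hxy, map_mul, map_mul, map_mul, map_mul, map_inv, map_inv, e.apply_symm_apply]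
        have hx1 := ((hmem _).1 x.2).2
        exact Prod.ext (by simp [hx1]) rfl
      rw [hy, map_mul, map_mul, map_inv]
      rfl
  refine ⟨ψ.comp (Subgroup.inclusion hN), D.comp_mem (D.inclusion_mem hN (D.le_of_mem hψ).1) hψ,
    fun x hx => ?_⟩
  have hxC : (x : G) ∈ C := (hmem _).2 ⟨(D.le_of_mem hω).1 x.2, hx⟩
  have h := DFunLike.congr_fun hψφ (ε ⟨x, hxC⟩)
  refine (congrArg Subtype.val h).trans ?_
  change ((ε.symm (ε ⟨x, hxC⟩) : C) : G) = x
  rw [ε.symm_apply_apply]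

theorem exists_equiv (hD : D.Splits e) (hs : D.Saturated) {P : Subgroup H} {R : Subgroup G}
    {ω : cylinder e P (D.sndCarrier e) ≃* R} (hω : ω.toMonoidHom ∈ D.Hom _ R) :
    ∃ (Q : Subgroup H) (ε : P ≃* Q), ε.toMonoidHom ∈ (D.factor e).Hom P Q ∧
      ∃ β ∈ D.Hom D.carrier D.carrier, ∀ x : cylinder e P (D.sndCarrier e),
        e (β ⟨ω x, (D.le_of_mem hω).2 (ω x).2⟩) = ((ε (cylinderFst e x) : H), (e x).2) := by
  obtain ⟨β, hβ, h⟩ := hD.exists_untwist hs hω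
  have hR := (D.le_of_mem hω).2
  obtain ⟨φ, hφ, H⟩ := hD.exists_mem_factor
    (D.comp_mem (D.comp_mem hω (D.inclusion_mem hR le_rfl)) hβ) h
  exact ⟨image φ, equivImage φ ((D.factor e).injective_of_mem hφ), equivImage_mem hφ, β, hβ, H⟩

/-- The factor `|Z(T₂)|` does not depend on `P`, so comparing centralizers in `D.factor e` amounts
to comparing those of cylinders in `D`. -/
theorem card_centralizerIn_cylinder (hD : D.Splits e) (P : Subgroup H) :
    Nat.card (D.centralizerIn (cylinder e P (D.sndCarrier e))) =
      Nat.card ((D.factor e).centralizerIn P) *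
        Nat.card (D.sndCarrier e ⊓ Subgroup.centralizer (D.sndCarrier e) : Subgroup K) := by
  rw [← card_cylinder e]
  congr 2
  ext x
  rw [mem_cylinder, mem_centralizerIn, mem_centralizerIn, Subgroup.mem_inf,
    Subgroup.mem_centralizer_iff]
  constructor
  · rintro ⟨hx, h⟩
    refine ⟨⟨hD.fst_mem x hx, fun a ha => ?_⟩, hD.snd_mem hx, fun b hb => ?_⟩
    · have := congrArg e (h (e.symm (a, 1)) (symm_mem_cylinder ha (one_mem _)))
      rw [map_mul, map_mul, e.apply_symm_apply] at this
      exact congrArg Prod.fst this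
    · have := congrArg e (h (e.symm (1, b)) (symm_mem_cylinder (one_mem _) hb))
      rw [map_mul, map_mul, e.apply_symm_apply] at this
      exact congrArg Prod.snd this
  · rintro ⟨⟨h1, h2⟩, h3, h4⟩
    refine ⟨cylinder_le le_rfl ⟨h1, h3⟩, fun y hy => e.injective ?_⟩
    rw [map_mul, map_mul]
    exact Prod.ext (h2 _ hy.1) (h4 _ hy.2)

theorem isConj_cylinder {P Q : Subgroup H} (h : (D.factor e).IsConj P Q) :
    D.IsConj (cylinder e P (D.sndCarrier e)) (cylinder e Q (D.sndCarrier e)) := by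
  obtain ⟨ε, hε⟩ := isConj_iff.1 h
  exact isConj_iff.2 ⟨cylinderEquiv e ε _, hε⟩

theorem card_center_pos (D : FusionSystem p G) (e : G ≃* H × K) :
    0 < Nat.card (D.sndCarrier e ⊓ Subgroup.centralizer (D.sndCarrier e) : Subgroup K) := by
  have := D.finite_carrier
  have : Finite (D.sndCarrier e ⊓ Subgroup.centralizer (D.sndCarrier e) : Subgroup K) := by
    refine Finite.of_injective (fun a => (⟨_, a.2.1⟩ : D.carrier)) fun a b hab => ?_
    exact Subtype.ext (congrArg Prod.snd (e.symm.injective (Subtype.mk.inj hab)))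
  exact Nat.card_pos

theorem fullyCentralized_factor (hD : D.Splits e) {P : Subgroup H}
    (h : D.FullyCentralized (cylinder e P (D.sndCarrier e))) :
    (D.factor e).FullyCentralized P := by
  intro Q hQ
  have := h _ (isConj_cylinder hQ)
  rw [hD.card_centralizerIn_cylinder, hD.card_centralizerIn_cylinder] at this
  exact Nat.le_of_mul_le_mul_right this (card_center_pos D e)

theorem card_centralizerIn_le_of_equiv {P Q : Subgroup H} {R : Subgroup G}
    (hR : R ≤ D.carrier) {ω : cylinder e P (D.sndCarrier e) ≃* R} {ε : P ≃* Q}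
    {β : D.carrier →* D.carrier} (hβ : β ∈ D.Hom D.carrier D.carrier)
    (h : ∀ x : cylinder e P (D.sndCarrier e),
        e (β ⟨ω x, hR (ω x).2⟩) = ((ε (cylinderFst e x) : H), (e x).2)) :
    Nat.card (D.centralizerIn R) ≤
      Nat.card (D.centralizerIn (cylinder e Q (D.sndCarrier e))) := by
  refine card_centralizerIn_le hβ hR fun y hy => ?_
  obtain ⟨a, ha⟩ := ε.surjective ⟨_, (mem_cylinder.1 hy).1⟩
  refine ⟨ω (cylinderMk e a ⟨_, (mem_cylinder.1 hy).2⟩), (ω _).2, e.injective ((h _).trans ?_)⟩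
  rw [cylinderFst_cylinderMk, ha, apply_cylinderMk]

/-- A conjugate `R` of `P × T₂` need not be a cylinder, but untwisting carries it to some `Q × T₂`
with `Q` conjugate to `P` in the factor, and embeds its centralizer in that of `Q × T₂`. -/
theorem fullyCentralized_cylinder (hD : D.Splits e) (hs : D.Saturated) {P : Subgroup H}
    (h : (D.factor e).FullyCentralized P) :
    D.FullyCentralized (cylinder e P (D.sndCarrier e)) := by
  intro R hR
  obtain ⟨ω, hω⟩ := isConj_iff.1 hR
  obtain ⟨Q, ε, hε, β, hβ, H⟩ := hD.exists_equiv hs hω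
  have hQ : (D.factor e).IsConj P Q := isConj_iff.2 ⟨ε, hε⟩
  refine (card_centralizerIn_le_of_equiv hR.le.2 hβ H).trans ?_
  rw [hD.card_centralizerIn_cylinder, hD.card_centralizerIn_cylinder]
  exact Nat.mul_le_mul_right _ (h Q hQ)

/-- Both axioms are those of `D` applied to `P × T₂`. In the first the isomorphism obtained from `D`
must be untwisted; in the second the extension of `(φ, id)` is already the identity on `T₂`, so it
has the form `(ψ₁, id)`. -/
theorem saturated_factor [Fact p.Prime] (hD : D.Splits e) (hs : D.Saturated) :
    (D.factor e).Saturated where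
  sylow P hP hn := by
    obtain ⟨Q⟩ : Nonempty (Sylow p ((D.factor e).aut hP)) := inferInstance
    have hP' := cylinder_le hP
    let ι : (D.factor e).aut hP →* D.aut hP' :=
      ((cylinderAut e P _).comp ((D.factor e).aut hP).subtype).codRestrict (D.aut hP')
        fun α => (mem_aut_iff hP').2 α.2.1
    obtain ⟨R, ω, hω, hc, hQ⟩ := hs.exists_conj hP' (Q.1.map ι) (Q.2.map ι)
    obtain ⟨P₁, ε, hε, β, hβ, hβω⟩ := hD.exists_equiv hs hω
    have hR := (D.le_of_mem hω).2
    have hPP₁ : (D.factor e).IsConj P P₁ := isConj_iff.2 ⟨ε, hε⟩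
    have hc₁ : D.FullyCentralized (cylinder e P₁ (D.sndCarrier e)) :=
      hc.of_card_le ((isConj_iff.2 ⟨ω, hω⟩ : D.IsConj _ _).symm.trans (isConj_cylinder hPP₁))
        (card_centralizerIn_le_of_equiv hR hβ hβω)
    refine hn.sylow_of_conj hP hε (hD.fullyCentralized_factor hc₁) Q fun α hα => ?_
    obtain ⟨k, hk, hkω⟩ := hQ _ ⟨α, hα, rfl⟩
    -- `β` turns conjugation by `k` into conjugation by `β(k)`; the first coordinate gives the
    -- action on `P₁`.
    refine ⟨(e (β ⟨k, hk⟩)).1, hD.fst_mem _ (β _).2, fun a => ?_⟩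
    set x : cylinder e P (D.sndCarrier e) := cylinderMk e a 1
    set y := ((ι α : D.aut hP') : MulAut (cylinder e P (D.sndCarrier e))) x
    have hx1 : cylinderFst e x = a := cylinderFst_cylinderMk e a 1
    have hy1 : cylinderFst e y = (α : MulAut P) a :=
      (Subtype.ext (congrArg Prod.fst (apply_cylinderMap e _ _ x))).trans
        (congrArg (α : MulAut P) hx1)
    have h1 : (⟨ω y, hR (ω y).2⟩ : D.carrier) = ⟨k, hk⟩ * ⟨ω x, hR (ω x).2⟩ * ⟨k, hk⟩⁻¹ :=
      Subtype.ext (hkω x)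
    have h2 := congrArg (fun z => (e (β z)).1) h1
    simp only [map_mul, map_inv, Subgroup.coe_mul, Subgroup.coe_inv, Prod.fst_mul, Prod.fst_inv]
      at h2
    rw [hβω, hβω, hy1, hx1] at h2
    exact h2
  extension P hP φ hφ hc := by
    have hP' := cylinder_le hP
    have hT := cylinder_le (le_refl (D.fstCarrier e))
    set φ' : cylinder e P (D.sndCarrier e) →* D.carrier :=
      (Subgroup.inclusion hT).comp (cylinderMap e φ (D.sndCarrier e))
    have hφ' : φ' ∈ D.Hom _ D.carrier := D.comp_mem hφ (D.inclusion_mem hT le_rfl)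
    have hφe : ∀ x, e (φ' x) = ((φ (cylinderFst e x) : H), (e x).2) := fun x =>
      apply_cylinderMap e φ _ x
    have him : image φ' = cylinder e (image φ) (D.sndCarrier e) := by
      ext y
      rw [mem_image, mem_cylinder, mem_image]
      constructor
      · rintro ⟨x, rfl⟩
        rw [hφe]
        exact ⟨⟨_, rfl⟩, x.2.2⟩
      · rintro ⟨⟨a, ha⟩, hb⟩
        refine ⟨cylinderMk e a ⟨_, hb⟩, e.injective ((hφe _).trans ?_)⟩
        rw [cylinderFst_cylinderMk, ha, apply_cylinderMk]
    have hc' : D.FullyCentralized (image φ') := by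
      rw [him]
      exact hD.fullyCentralized_cylinder hs hc
    obtain ⟨ψ, hψ, hψφ⟩ := hs.extension _ hP' φ' hφ' hc'
    have hconj : ∀ {R : Subgroup H} {g : G}, g ∈ D.carrier → (e g).1 ∈ (D.factor e).normalizerIn R →
        g ∈ D.normalizerIn (cylinder e R (D.sndCarrier e)) := by
      intro R g hg h
      refine ⟨hg, Subgroup.mem_normalizer_iff.2 fun x => ?_⟩
      rw [mem_cylinder, mem_cylinder, map_mul, map_mul, map_inv]
      refine and_congr (Subgroup.mem_normalizer_iff.1 h.2 _) ?_
      rw [Prod.snd_mul, Prod.snd_mul, Prod.snd_inv,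
        Subgroup.mul_mem_cancel_right _ (inv_mem (hD.snd_mem hg)),
        Subgroup.mul_mem_cancel_left _ (hD.snd_mem hg)]
    have hN : cylinder e ((D.factor e).extensionSubgroup φ) (D.sndCarrier e) ≤
        D.extensionSubgroup φ' := by
      rintro g ⟨⟨h1, k, hk, h2⟩, h3⟩
      have hg : g ∈ D.carrier := hT ⟨h1.1, h3⟩
      have hkc : e.symm (k, (e g).2) ∈ D.carrier := hT (symm_mem_cylinder hk.1 h3)
      -- As `(φ, id)` fixes second coordinates, the element matching `g` is `k` paired with the
      -- second coordinate of `g`.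
      refine ⟨hconj hg h1, e.symm (k, (e g).2), ?_, fun x y hxy => e.injective ?_⟩
      · rw [him]
        refine hconj hkc ?_
        rw [e.apply_symm_apply]
        exact hk
      · have hxy' := congrArg e hxy
        rw [map_mul, map_mul, map_inv] at hxy'
        rw [map_mul, map_mul, map_inv, hφe, hφe, e.apply_symm_apply]
        exact Prod.ext (h2 (cylinderFst e x) (cylinderFst e y) (congrArg Prod.fst hxy'))
          (congrArg Prod.snd hxy' :)
    have hψφ' : ∀ x : cylinder e P (D.sndCarrier e),
        ψ ⟨x, D.le_extensionSubgroup φ' hP' le_rfl x.2⟩ = φ' x := DFunLike.congr_fun hψφ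
    obtain ⟨ψ₁, hψ₁, H⟩ := hD.exists_mem_factor
      (D.comp_mem (D.inclusion_mem hN (D.le_of_mem hψ).1) hψ) fun x hx => by
        have hxP : (x : G) ∈ cylinder e P (D.sndCarrier e) := mem_cylinder.2 ⟨by
          rw [hx]
          exact one_mem _, x.2.2⟩
        refine (congrArg Subtype.val (hψφ' ⟨x, hxP⟩)).trans (e.injective ((hφe _).trans ?_))
        refine Prod.ext ?_ rfl
        have : cylinderFst e (⟨x, hxP⟩ : cylinder e P (D.sndCarrier e)) = 1 := Subtype.ext hx
        rw [this, map_one]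
        exact hx.symm
    refine ⟨ψ₁, hψ₁, MonoidHom.ext fun a => Subtype.ext ?_⟩
    have h1 := H (cylinderMk e (Subgroup.inclusion
      ((D.factor e).le_extensionSubgroup φ hP le_rfl) a) 1)
    have h2 := hφe (cylinderMk e a 1)
    rw [← hψφ'] at h2
    rw [cylinderFst_cylinderMk] at h1 h2
    exact congrArg Prod.fst (h1.symm.trans h2)

end Splits

end Factor

end FusionSystem

namespace FusionSystem

/-! ### Normal subgroups under split epimorphisms -/

section Normal

variable {p : ℕ} {G H : Type*} [Group G] [Group H] {F : FusionSystem p G} {F' : FusionSystem p H}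

theorem isNormalSubgroup_bot (F : FusionSystem p G) : F.IsNormalSubgroup ⊥ := by
  refine ⟨bot_le, by rw [Subgroup.bot_subgroupOf]; infer_instance, fun Q R φ hφ => ?_⟩
  have hle := F.le_of_mem hφ
  have hQ : ⊥ ⊔ Q ≤ Q := sup_le bot_le le_rfl
  refine ⟨(Subgroup.inclusion le_sup_right).comp (φ.comp (Subgroup.inclusion hQ)),
    F.mem_of_restrict hφ hQ (sup_le bot_le hle.2) _ fun _ => rfl, MonoidHom.ext fun x => rfl, ?_⟩
  rw [Subgroup.bot_subgroupOf, Subgroup.bot_subgroupOf, Subgroup.map_bot]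

/-- The image of a normal subgroup of `F` under a split epimorphism of fusion systems is
normal. -/
theorem IsNormalSubgroup.map {π : G →* H} {i : H →* G} (hπ : IsMorphism F F' π)
    (hi : IsMorphism F' F i) (hπi : ∀ a, π (i a) = a) {P : Subgroup G}
    (hP : F.IsNormalSubgroup P) : F'.IsNormalSubgroup (P.map π) := by
  refine ⟨hπ.map_le hP.1, ⟨?_⟩, fun Q R φ hφ => ?_⟩
  · rintro ⟨_, hn⟩ ⟨y, hy, rfl⟩ s
    have his : i s ∈ F.carrier := hi.map_le le_rfl ⟨s, s.2, rfl⟩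
    refine ⟨_, hP.2.1.conj_mem ⟨y, hP.1 hy⟩ hy ⟨_, his⟩, ?_⟩
    change π (i s * y * (i s)⁻¹) = s * π y * (s : H)⁻¹
    rw [map_mul, map_mul, map_inv, hπi]
  -- Transport `φ` along `i`, extend it in `F` over `P · i(Q)`, and project back; `π(P · i(Q)) =
  -- π(P) Q`.
  · obtain ⟨φ', hφ', hφφ'⟩ := hi _ _ _ hφ
    obtain ⟨ψ, hψ, hψφ, hψP⟩ := hP.2.2 _ _ _ hφ'
    obtain ⟨ψ', hψ', hψψ'⟩ := hπ _ _ _ hψ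
    have hmap : ∀ Q : Subgroup _, (P ⊔ Q.map i).map π = P.map π ⊔ Q := fun Q => by
      rw [Subgroup.map_sup, Subgroup.map_map]
      congr 1
      have : π.comp i = MonoidHom.id _ := MonoidHom.ext hπi
      rw [this, Subgroup.map_id]
    have hR := (F'.le_of_mem hψ').2
    refine ⟨(Subgroup.inclusion (hmap R).le).comp (ψ'.comp (Subgroup.inclusion (hmap Q).ge)),
      F'.mem_of_restrict hψ' (hmap Q).ge ((hmap R).ge.trans hR) _ fun _ => rfl,
      MonoidHom.ext fun x => Subtype.ext ?_, le_antisymm ?_ ?_⟩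
    · have hix : i x ∈ Q.map i := ⟨x, x.2, rfl⟩
      have e1 : Subgroup.inclusion (hmap Q).ge (Subgroup.inclusion le_sup_right x) =
          ⟨π (i x), Subgroup.mem_map_of_mem π (Subgroup.mem_sup_right hix)⟩ :=
        Subtype.ext (hπi x).symm
      have e2 : (ψ ⟨i x, Subgroup.mem_sup_right hix⟩ : G) = φ' ⟨i x, hix⟩ :=
        congrArg Subtype.val (DFunLike.congr_fun hψφ ⟨i x, hix⟩)
      change ((ψ' (Subgroup.inclusion (hmap Q).ge (Subgroup.inclusion le_sup_right x)) :
        Subgroup.map π _) : H) = _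
      rw [e1]
      refine (hψψ' ⟨i x, Subgroup.mem_sup_right hix⟩).trans ?_
      rw [e2, hφφ', hπi]
      rfl
    · rintro _ ⟨⟨_, _⟩, ⟨y, hy, rfl⟩, rfl⟩
      have hm : ψ ⟨y, Subgroup.mem_sup_left hy⟩ ∈ P.subgroupOf (P ⊔ R.map i) := by
        rw [← hψP]
        exact ⟨_, hy, rfl⟩
      exact ⟨_, hm, (hψψ' ⟨y, Subgroup.mem_sup_left hy⟩).symm⟩
    · rintro ⟨_, hz⟩ ⟨w, hw, rfl⟩
      have hm : (⟨w, Subgroup.mem_sup_left hw⟩ : (P ⊔ R.map i : Subgroup G)) ∈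
        P.subgroupOf (P ⊔ R.map i) := hw
      rw [← hψP] at hm
      obtain ⟨y, hy, hyw⟩ := hm
      refine ⟨⟨π y, Subgroup.mem_sup_left ⟨y, hy, rfl⟩⟩, ⟨y, hy, rfl⟩, Subtype.ext ?_⟩
      exact (hψψ' y).trans (congrArg π (congrArg Subtype.val hyw))

end Normal

/-! ### Direct factors inherit subsystems of `p`-power index and of index prime to `p` -/

section IsFactor

variable {p : ℕ} {G H K : Type*} [Group G] [Group H] [Group K]

/-- `F₁` is a direct factor of `F`: the projection and the inclusion are morphisms of fusion
systems, and so are the homomorphisms `(φ, id) : P × T → Q × T` for `φ` in `F₁`. -/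
structure IsFactor (F : FusionSystem p G) (F₁ : FusionSystem p H) (e : G ≃* H × K) : Prop where
  proj : IsMorphism F F₁ ((MonoidHom.fst H K).comp e.toMonoidHom)
  incl : IsMorphism F₁ F (e.symm.toMonoidHom.comp (MonoidHom.inl H K))
  cylinderMap_mem : ∀ {P Q : Subgroup H} {φ : P →* Q} {T : Subgroup K}, φ ∈ F₁.Hom P Q →
    cylinder e ⊥ T ≤ F.carrier → cylinderMap e φ T ∈ F.Hom _ _
  snd_eq_one : ∀ {P Q : Subgroup G} {φ : P →* Q}, φ ∈ F.Hom P Q →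
    ∀ x : P, (e x).2 = 1 → (e (φ x)).2 = 1

namespace IsFactor

variable {F : FusionSystem p G} {F₁ : FusionSystem p H} {e : G ≃* H × K}

theorem le_factor (h : IsFactor F F₁ e) : F₁ ≤ F.factor e :=
  ⟨fun a ha => h.incl.map_le le_rfl ⟨a, ha, rfl⟩,
    fun _ _ _ hφ => h.cylinderMap_mem hφ (cylinder_le bot_le)⟩

/-- The projection of `(φ, id)` restricts to `φ`. For `D = F`, together with `le_factor`, this
recovers `F₁` from `F`. -/
theorem factor_le (h : IsFactor F F₁ e) {D : FusionSystem p G} (hD : D ≤ F) :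
    D.factor e ≤ F₁ := by
  have hc : (D.factor e).carrier ≤ F₁.carrier := fun a ha =>
    h.proj.map_le le_rfl ⟨_, hD.1 ha, congrArg Prod.fst (e.apply_symm_apply (a, 1))⟩
  refine ⟨hc, fun P Q φ hφ => ?_⟩
  obtain ⟨φ', hφ', H'⟩ := h.proj _ _ _ (hD.2 _ _ hφ)
  have hle : P ≤ (cylinder e P (D.sndCarrier e)).map
      ((MonoidHom.fst H K).comp e.toMonoidHom) := fun a ha =>
    ⟨_, (cylinderMk e ⟨a, ha⟩ 1).2, congrArg Prod.fst (apply_cylinderMk e ⟨a, ha⟩ 1)⟩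
  refine F₁.mem_of_restrict hφ' hle (((D.factor e).le_of_mem hφ).2.trans hc) φ fun a => ?_
  have h1 : (⟨a, hle a.2⟩ : (cylinder e P (D.sndCarrier e)).map
      ((MonoidHom.fst H K).comp e.toMonoidHom)) = ⟨_, Subgroup.mem_map_of_mem _
        (cylinderMk e a (1 : D.sndCarrier e)).2⟩ :=
    Subtype.ext (congrArg Prod.fst (apply_cylinderMk e a (1 : D.sndCarrier e))).symm
  rw [h1, H']
  have h2 := congrArg Prod.fst (apply_cylinderMap e φ (D.sndCarrier e) (cylinderMk e a 1))
  rw [cylinderFst_cylinderMk] at h2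
  exact h2.symm

theorem splits (h : IsFactor F F₁ e) {D : FusionSystem p G} (hD : D ≤ F)
    (hc : ∀ x ∈ D.carrier, (e x).1 ∈ D.fstCarrier e) : D.Splits e where
  fst_mem := hc
  fst_eq_one hφ x hx := by
    obtain ⟨φ', -, H'⟩ := h.proj _ _ _ (hD.2 _ _ hφ)
    refine (H' x).symm.trans ?_
    have : (⟨_, Subgroup.mem_map_of_mem ((MonoidHom.fst H K).comp e.toMonoidHom) x.2⟩ :
      Subgroup.map _ _) = 1 := Subtype.ext hx
    rw [this, map_one]
    rfl
  snd_eq_one hφ x hx := h.snd_eq_one (hD.2 _ _ hφ) x hx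

theorem exists_aut_cylinder (h : IsFactor F F₁ e) {P : Subgroup H} (hP : P ≤ F₁.carrier)
    {T : Subgroup K} (hT : cylinder e P T ≤ F.carrier) :
    ∃ ι : F₁.aut hP →* F.aut hT, ∀ α : F₁.aut hP,
      (ι α : MulAut (cylinder e P T)) = cylinderAut e P T α :=
  ⟨((cylinderAut e P T).comp (F₁.aut hP).subtype).codRestrict (F.aut hT) fun α =>
    (mem_aut_iff hT).2 (h.cylinderMap_mem α.2.1
      ((Subgroup.comap_mono (Subgroup.prod_mono bot_le le_rfl)).trans hT)), fun _ => rfl⟩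

theorem fst_mem_hyperfocal [Fact p.Prime] (h : IsFactor F F₁ e) {x : G} (hx : x ∈ F.hyperfocal) :
    (e x).1 ∈ F₁.hyperfocal :=
  h.proj.map_hyperfocal_le ⟨x, hx, rfl⟩

theorem symm_mem_hyperfocal [Fact p.Prime] (h : IsFactor F F₁ e) {a : H}
    (ha : a ∈ F₁.hyperfocal) : e.symm (a, 1) ∈ F.hyperfocal :=
  h.incl.map_hyperfocal_le ⟨a, ha, rfl⟩

/-- The homomorphism `α ↦ (α, id)` from `Aut_{F₁}(P)` to `Aut_F(P × T₂)` sends `O^p` into `O^p`,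
which lies in `D`. Being over `hyp(F)`, whose elements have their coordinates in it, makes `D`
split. -/
theorem hasPPowerIndex_factor [Fact p.Prime] (h : IsFactor F F₁ e) {D : FusionSystem p G}
    (hD : F.HasPPowerIndex D) (hDc : D.carrier = F.hyperfocal) :
    F₁.HasPPowerIndex (D.factor e) ∧ (D.factor e).carrier = F₁.hyperfocal := by
  have hle : F₁.hyperfocal ≤ D.fstCarrier e := fun a ha => hD.hyperfocal_le (h.symm_mem_hyperfocal ha)
  refine ⟨⟨(h.splits hD.le fun x hx => hle (h.fst_mem_hyperfocal (hDc ▸ hx))).saturated_factor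
    hD.saturated, h.factor_le hD.le, hle, fun P hP => ?_⟩, le_antisymm (fun a ha => ?_) hle⟩
  · obtain ⟨ι, hι⟩ := h.exists_aut_cylinder (hP.trans (h.factor_le hD.le).1)
      ((cylinder_le hP).trans hD.le.1)
    rintro _ ⟨α, hα, rfl⟩
    have := hD.residual_le _ (cylinder_le hP) ⟨_, map_pPowerResidual_le ι ⟨α, hα, rfl⟩, rfl⟩
    rw [Subgroup.coe_subtype, hι] at this
    exact (mem_aut_iff hP).2 this.1
  · have ha' : e.symm (a, 1) ∈ D.carrier := ha
    rw [hDc] at ha'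
    have := h.fst_mem_hyperfocal ha'
    rwa [e.apply_symm_apply] at this

theorem hasIndexPrimeTo_factor [Fact p.Prime] (h : IsFactor F F₁ e) {D : FusionSystem p G}
    (hD : F.HasIndexPrimeTo D) : F₁.HasIndexPrimeTo (D.factor e) := by
  have hle : F₁.carrier ≤ D.fstCarrier e := fun a ha => by
    change e.symm (a, 1) ∈ D.carrier
    rw [hD.carrier_eq]
    exact h.incl.map_le le_rfl ⟨a, ha, rfl⟩
  refine ⟨(h.splits hD.le fun x hx => hle (h.proj.map_le le_rfl
    ⟨x, hD.le.1 hx, rfl⟩)).saturated_factor hD.saturated, h.factor_le hD.le,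
    le_antisymm (h.factor_le hD.le).1 hle, fun P hP => ?_⟩
  obtain ⟨ι, hι⟩ := h.exists_aut_cylinder (hP.trans (h.factor_le hD.le).1)
    ((cylinder_le hP).trans hD.le.1)
  rintro _ ⟨α, hα, rfl⟩
  have := hD.residual_le _ (cylinder_le hP) ⟨_, map_pPrimeResidual_le ι ⟨α, hα, rfl⟩, rfl⟩
  rw [Subgroup.coe_subtype, hι] at this
  exact (mem_aut_iff hP).2 this.1

end IsFactor

end IsFactor

/-! ### Cores, hyperfocal subgroups and least subsystems of a product -/

section Prod

variable {p : ℕ} {G₁ G₂ : Type*} [Group G₁] [Group G₂]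
  {F₁ : FusionSystem p G₁} {F₂ : FusionSystem p G₂}

theorem isMorphism_inl (F₁ : FusionSystem p G₁) (F₂ : FusionSystem p G₂) :
    IsMorphism F₁ (F₁.prod F₂) (MonoidHom.inl G₁ G₂) := by
  intro P Q φ hφ
  have hP : P.map (MonoidHom.inl G₁ G₂) ≤ P.prod ⊥ := by
    rintro _ ⟨a, ha, rfl⟩
    exact ⟨ha, one_mem _⟩
  have hQ : Q.prod ⊥ ≤ Q.map (MonoidHom.inl G₁ G₂) := fun x hx =>
    ⟨x.1, hx.1, Prod.ext rfl (Subgroup.mem_bot.1 hx.2).symm⟩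
  refine ⟨(Subgroup.inclusion hQ).comp (pairHom hP φ (MonoidHom.id (⊥ : Subgroup G₂))),
    prod_mem hφ (F₂.inclusion_mem (le_refl ⊥) bot_le) hP ?_ _ fun _ => rfl, fun x => rfl⟩
  rintro _ ⟨a, ha, rfl⟩
  exact ⟨(F₁.le_of_mem hφ).2 ha, one_mem _⟩

theorem isMorphism_inr (F₁ : FusionSystem p G₁) (F₂ : FusionSystem p G₂) :
    IsMorphism F₂ (F₁.prod F₂) (MonoidHom.inr G₁ G₂) := by
  intro P Q φ hφ
  have hP : P.map (MonoidHom.inr G₁ G₂) ≤ (⊥ : Subgroup G₁).prod P := by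
    rintro _ ⟨a, ha, rfl⟩
    exact ⟨one_mem _, ha⟩
  have hQ : (⊥ : Subgroup G₁).prod Q ≤ Q.map (MonoidHom.inr G₁ G₂) := fun x hx =>
    ⟨x.2, hx.2, Prod.ext (Subgroup.mem_bot.1 hx.1).symm rfl⟩
  refine ⟨(Subgroup.inclusion hQ).comp (pairHom hP (MonoidHom.id (⊥ : Subgroup G₁)) φ),
    prod_mem (F₁.inclusion_mem (le_refl ⊥) bot_le) hφ hP ?_ _ fun _ => rfl, fun x => rfl⟩
  rintro _ ⟨a, ha, rfl⟩
  exact ⟨one_mem _, (F₂.le_of_mem hφ).2 ha⟩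

theorem isFactor_fst (F₁ : FusionSystem p G₁) (F₂ : FusionSystem p G₂) :
    IsFactor (F₁.prod F₂) F₁ (MulEquiv.refl (G₁ × G₂)) where
  proj := isMorphism_fst F₁ F₂
  incl := isMorphism_inl F₁ F₂
  cylinderMap_mem := by
    intro P Q φ T hφ hT
    have hT' : T ≤ F₂.carrier := fun b hb => (hT (x := (1, b)) ⟨one_mem _, hb⟩).2
    have hP : cylinder (MulEquiv.refl (G₁ × G₂)) P T ≤ P.prod T := fun x hx => hx
    have hQ : cylinder (MulEquiv.refl (G₁ × G₂)) Q T ≤ (F₁.prod F₂).carrier :=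
      fun x hx => ⟨(F₁.le_of_mem hφ).2 hx.1, hT' hx.2⟩
    exact prod_mem hφ (F₂.inclusion_mem (le_refl T) hT') hP hQ _ fun x => rfl
  snd_eq_one := by
    rintro P Q φ ⟨φ₁, h₁, φ₂, h₂, h⟩ x hx
    refine (congrArg Prod.snd (h x)).trans ?_
    have : toProj₂ P x = 1 := Subtype.ext hx
    rw [this, map_one]
    rfl

theorem isFactor_snd (F₁ : FusionSystem p G₁) (F₂ : FusionSystem p G₂) :
    IsFactor (F₁.prod F₂) F₂ (MulEquiv.prodComm : G₁ × G₂ ≃* G₂ × G₁) where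
  proj := isMorphism_snd F₁ F₂
  incl := isMorphism_inr F₁ F₂
  cylinderMap_mem := by
    intro P Q φ T hφ hT
    have hT' : T ≤ F₁.carrier := fun b hb => (hT (x := (b, 1)) ⟨one_mem _, hb⟩).1
    have hP : cylinder (MulEquiv.prodComm : G₁ × G₂ ≃* G₂ × G₁) P T ≤ T.prod P :=
      fun x hx => ⟨hx.2, hx.1⟩
    have hQ : cylinder (MulEquiv.prodComm : G₁ × G₂ ≃* G₂ × G₁) Q T ≤ (F₁.prod F₂).carrier :=
      fun x hx => ⟨hT' hx.2, (F₂.le_of_mem hφ).2 hx.1⟩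
    exact prod_mem (F₁.inclusion_mem (le_refl T) hT') hφ hP hQ _ fun x => rfl
  snd_eq_one := by
    rintro P Q φ ⟨φ₁, h₁, φ₂, h₂, h⟩ x hx
    refine (congrArg Prod.fst (h x)).trans ?_
    have : toProj₁ P x = 1 := Subtype.ext hx
    rw [this, map_one]
    rfl

theorem IsNormalSubgroup.prod {P₁ : Subgroup G₁} {P₂ : Subgroup G₂} (h₁ : F₁.IsNormalSubgroup P₁)
    (h₂ : F₂.IsNormalSubgroup P₂) : (F₁.prod F₂).IsNormalSubgroup (P₁.prod P₂) := by
  refine ⟨Subgroup.prod_mono h₁.1 h₂.1, ⟨fun n hn g => ⟨?_, ?_⟩⟩, ?_⟩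
  · exact h₁.2.1.conj_mem ⟨n.1.1, n.2.1⟩ hn.1 ⟨g.1.1, g.2.1⟩
  · exact h₂.2.1.conj_mem ⟨n.1.2, n.2.2⟩ hn.2 ⟨g.1.2, g.2.2⟩
  rintro Q R φ hφ
  have hR := ((F₁.prod F₂).le_of_mem hφ).2
  obtain ⟨φ₁, hφ₁, φ₂, hφ₂, h⟩ := hφ
  obtain ⟨ψ₁, hψ₁, e₁, m₁⟩ := h₁.2.2 _ _ _ hφ₁
  obtain ⟨ψ₂, hψ₂, e₂, m₂⟩ := h₂.2.2 _ _ _ hφ₂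
  have hPm : P₁.prod P₂ ≤ (P₁ ⊔ proj₁ Q).prod (P₂ ⊔ proj₂ Q) :=
    Subgroup.prod_mono le_sup_left le_sup_left
  have hQm : Q ≤ (P₁ ⊔ proj₁ Q).prod (P₂ ⊔ proj₂ Q) :=
    (le_prod_proj Q).trans (Subgroup.prod_mono le_sup_right le_sup_right)
  have hle : P₁.prod P₂ ⊔ Q ≤ (P₁ ⊔ proj₁ Q).prod (P₂ ⊔ proj₂ Q) := sup_le hPm hQm
  set χ := pairHom hle ψ₁ ψ₂
  have hχP : ∀ x (hx : x ∈ P₁.prod P₂), (χ ⟨x, Subgroup.mem_sup_left hx⟩ : G₁ × G₂) ∈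
      P₁.prod P₂ := by
    intro x hx
    have a₁ : ψ₁ ⟨x.1, (hPm hx).1⟩ ∈ P₁.subgroupOf (P₁ ⊔ proj₁ R) := m₁ ▸ ⟨_, hx.1, rfl⟩
    have a₂ : ψ₂ ⟨x.2, (hPm hx).2⟩ ∈ P₂.subgroupOf (P₂ ⊔ proj₂ R) := m₂ ▸ ⟨_, hx.2, rfl⟩
    exact ⟨a₁, a₂⟩
  have hχQ : ∀ x (hx : x ∈ Q), (χ ⟨x, Subgroup.mem_sup_right hx⟩ : G₁ × G₂) = φ ⟨x, hx⟩ := by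
    intro x hx
    have a₁ : (ψ₁ ⟨x.1, (hQm hx).1⟩ : G₁) = φ₁ (toProj₁ Q ⟨x, hx⟩) :=
      congrArg Subtype.val (DFunLike.congr_fun e₁ (toProj₁ Q ⟨x, hx⟩))
    have a₂ : (ψ₂ ⟨x.2, (hQm hx).2⟩ : G₂) = φ₂ (toProj₂ Q ⟨x, hx⟩) :=
      congrArg Subtype.val (DFunLike.congr_fun e₂ (toProj₂ Q ⟨x, hx⟩))
    rw [h ⟨x, hx⟩]
    exact Prod.ext a₁ a₂
  -- The elements sent into `(P₁ × P₂)R` form a subgroup containing both `P₁ × P₂` and `Q`.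
  have hχ : ∀ x, (χ x : G₁ × G₂) ∈ P₁.prod P₂ ⊔ R := by
    have : P₁.prod P₂ ⊔ Q ≤ ((P₁.prod P₂ ⊔ R).comap ((Subgroup.subtype _).comp χ)).map
        (Subgroup.subtype _) := sup_le
      (fun x hx => ⟨⟨x, Subgroup.mem_sup_left hx⟩, Subgroup.mem_sup_left (hχP x hx), rfl⟩)
      (fun x hx => ⟨⟨x, Subgroup.mem_sup_right hx⟩, Subgroup.mem_sup_right (by
        change (χ _ : G₁ × G₂) ∈ R
        rw [hχQ x hx]
        exact (φ _).2), rfl⟩)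
    intro x
    obtain ⟨y, hy, hyx⟩ := this x.2
    rwa [Subtype.ext hyx] at hy
  refine ⟨((Subgroup.subtype _).comp χ).codRestrict _ hχ,
    prod_mem hψ₁ hψ₂ hle (sup_le (Subgroup.prod_mono h₁.1 h₂.1) hR) _ fun _ => rfl,
    MonoidHom.ext fun x => Subtype.ext (hχQ x x.2), le_antisymm ?_ ?_⟩
  · rintro _ ⟨x, hx, rfl⟩
    exact hχP x hx
  · rintro y hy
    have a₁ : (⟨y.1.1, Subgroup.mem_sup_left hy.1⟩ : (P₁ ⊔ proj₁ R : Subgroup G₁)) ∈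
      P₁.subgroupOf (P₁ ⊔ proj₁ R) := hy.1
    have a₂ : (⟨y.1.2, Subgroup.mem_sup_left hy.2⟩ : (P₂ ⊔ proj₂ R : Subgroup G₂)) ∈
      P₂.subgroupOf (P₂ ⊔ proj₂ R) := hy.2
    rw [← m₁] at a₁
    rw [← m₂] at a₂
    obtain ⟨x₁, hx₁, hxy₁⟩ := a₁
    obtain ⟨x₂, hx₂, hxy₂⟩ := a₂
    have hx : ((x₁ : G₁), (x₂ : G₂)) ∈ P₁.prod P₂ := ⟨hx₁, hx₂⟩
    exact ⟨⟨_, Subgroup.mem_sup_left hx⟩, hx, Subtype.ext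
      (Prod.ext (congrArg Subtype.val hxy₁) (congrArg Subtype.val hxy₂))⟩

theorem core_prod (F₁ : FusionSystem p G₁) (F₂ : FusionSystem p G₂) :
    (F₁.prod F₂).core = F₁.core.prod F₂.core := by
  refine le_antisymm (sSup_le fun P hP => ?_) fun x hx => ?_
  · exact (le_prod_proj P).trans (Subgroup.prod_mono
      (le_sSup (hP.map (isMorphism_fst F₁ F₂) (isMorphism_inl F₁ F₂) fun _ => rfl))
      (le_sSup (hP.map (isMorphism_snd F₁ F₂) (isMorphism_inr F₁ F₂) fun _ => rfl)))
  · have l₁ : F₁.core ≤ (F₁.prod F₂).core.comap (MonoidHom.inl G₁ G₂) := sSup_le fun P hP a ha =>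
      le_sSup (a := P.prod ⊥) (hP.prod F₂.isNormalSubgroup_bot) ⟨ha, one_mem _⟩
    have l₂ : F₂.core ≤ (F₁.prod F₂).core.comap (MonoidHom.inr G₁ G₂) := sSup_le fun P hP a ha =>
      le_sSup (a := Subgroup.prod ⊥ P) (F₁.isNormalSubgroup_bot.prod hP) ⟨one_mem _, ha⟩
    have h₁ : (x.1, (1 : G₂)) ∈ (F₁.prod F₂).core := l₁ hx.1
    have h₂ : ((1 : G₁), x.2) ∈ (F₁.prod F₂).core := l₂ hx.2
    simpa using mul_mem h₁ h₂

theorem hyperfocal_prod [Fact p.Prime] (F₁ : FusionSystem p G₁) (F₂ : FusionSystem p G₂) :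
    (F₁.prod F₂).hyperfocal = F₁.hyperfocal.prod F₂.hyperfocal := by
  refine le_antisymm (fun x hx => ⟨(isFactor_fst F₁ F₂).fst_mem_hyperfocal hx,
    (isFactor_snd F₁ F₂).fst_mem_hyperfocal hx⟩) fun x hx => ?_
  have := mul_mem ((isFactor_fst F₁ F₂).symm_mem_hyperfocal hx.1)
    ((isFactor_snd F₁ F₂).symm_mem_hyperfocal hx.2)
  simpa using this

theorem prod_mono {E₁ : FusionSystem p G₁} {E₂ : FusionSystem p G₂} (h₁ : E₁ ≤ F₁)
    (h₂ : E₂ ≤ F₂) : E₁.prod E₂ ≤ F₁.prod F₂ :=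
  ⟨Subgroup.prod_mono h₁.1 h₂.1, fun _ _ _ ⟨φ₁, hφ₁, φ₂, hφ₂, h⟩ =>
    ⟨φ₁, h₁.2 _ _ hφ₁, φ₂, h₂.2 _ _ hφ₂, h⟩⟩

theorem mem_aut_prod {P : Subgroup (G₁ × G₂)} (hP : P ≤ (F₁.prod F₂).carrier) {α : MulAut P}
    {α₁ : MulAut (proj₁ P)} {α₂ : MulAut (proj₂ P)} (h₁ : α₁ ∈ F₁.aut (proj₁_le hP))
    (h₂ : α₂ ∈ F₂.aut (proj₂_le hP))
    (h : ∀ x : P, (α x : G₁ × G₂) = ((α₁ (toProj₁ P x) : G₁), (α₂ (toProj₂ P x) : G₂))) :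
    α ∈ (F₁.prod F₂).aut hP :=
  (mem_aut_iff hP).2 ⟨_, h₁.1, _, h₂.1, h⟩

/-- Projection sends `O^p(Aut_F(P))` into each `O^p(Aut_{Fᵢ}(Pᵢ))`, hence into `Dᵢ`; an automorphism
of `P` with both components in the `Dᵢ` lies in the product. -/
theorem HasPPowerIndex.prod [Fact p.Prime] {D₁ : FusionSystem p G₁} {D₂ : FusionSystem p G₂}
    (h₁ : F₁.HasPPowerIndex D₁) (h₂ : F₂.HasPPowerIndex D₂) :
    (F₁.prod F₂).HasPPowerIndex (D₁.prod D₂) where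
  saturated := h₁.saturated.prod h₂.saturated
  le := prod_mono h₁.le h₂.le
  hyperfocal_le := by
    rw [hyperfocal_prod]
    exact Subgroup.prod_mono h₁.hyperfocal_le h₂.hyperfocal_le
  residual_le P hP := by
    have hP' := hP.trans (prod_mono h₁.le h₂.le).1
    obtain ⟨f₁, hf₁⟩ := (isMorphism_fst F₁ F₂).exists_aut hP'
    obtain ⟨f₂, hf₂⟩ := (isMorphism_snd F₁ F₂).exists_aut hP'
    rintro _ ⟨α, hα, rfl⟩
    exact mem_aut_prod hP
      (h₁.residual_le _ (proj₁_le hP) ⟨_, map_pPowerResidual_le f₁ ⟨α, hα, rfl⟩, rfl⟩)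
      (h₂.residual_le _ (proj₂_le hP) ⟨_, map_pPowerResidual_le f₂ ⟨α, hα, rfl⟩, rfl⟩)
      fun x => Prod.ext (hf₁ α x).symm (hf₂ α x).symm

theorem HasIndexPrimeTo.prod [Fact p.Prime] {D₁ : FusionSystem p G₁} {D₂ : FusionSystem p G₂}
    (h₁ : F₁.HasIndexPrimeTo D₁) (h₂ : F₂.HasIndexPrimeTo D₂) :
    (F₁.prod F₂).HasIndexPrimeTo (D₁.prod D₂) where
  saturated := h₁.saturated.prod h₂.saturated
  le := prod_mono h₁.le h₂.le
  carrier_eq := congrArg₂ Subgroup.prod h₁.carrier_eq h₂.carrier_eq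
  residual_le P hP := by
    have hP' := hP.trans (prod_mono h₁.le h₂.le).1
    obtain ⟨f₁, hf₁⟩ := (isMorphism_fst F₁ F₂).exists_aut hP'
    obtain ⟨f₂, hf₂⟩ := (isMorphism_snd F₁ F₂).exists_aut hP'
    rintro _ ⟨α, hα, rfl⟩
    exact mem_aut_prod hP
      (h₁.residual_le _ (proj₁_le hP) ⟨_, map_pPrimeResidual_le f₁ ⟨α, hα, rfl⟩, rfl⟩)
      (h₂.residual_le _ (proj₂_le hP) ⟨_, map_pPrimeResidual_le f₂ ⟨α, hα, rfl⟩, rfl⟩)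
      fun x => Prod.ext (hf₁ α x).symm (hf₂ α x).symm

theorem prod_factor_le (D : FusionSystem p (G₁ × G₂)) :
    (D.factor (MulEquiv.refl (G₁ × G₂))).prod
      (D.factor (MulEquiv.prodComm : G₁ × G₂ ≃* G₂ × G₁)) ≤ D := by
  have hc : ∀ {x : G₁ × G₂}, (x.1, (1 : G₂)) ∈ D.carrier → ((1 : G₁), x.2) ∈ D.carrier →
      x ∈ D.carrier := fun h h' => by simpa using mul_mem h h'
  refine ⟨fun x hx => hc hx.1 hx.2, ?_⟩
  rintro P Q φ ⟨φ₁, h₁, φ₂, h₂, h⟩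
  have hle₁ := (FusionSystem.factor D (MulEquiv.refl (G₁ × G₂))).le_of_mem h₁
  have hle₂ := (FusionSystem.factor D (MulEquiv.prodComm : G₁ × G₂ ≃* G₂ × G₁)).le_of_mem h₂
  have hQ : Q ≤ D.carrier := fun x hx => hc (hle₁.2 ⟨x, hx, rfl⟩) (hle₂.2 ⟨x, hx, rfl⟩)
  have hP : P ≤ cylinder (MulEquiv.refl (G₁ × G₂)) (proj₁ P) (D.sndCarrier (MulEquiv.refl _)) :=
    fun x hx => ⟨⟨x, hx, rfl⟩, hle₂.1 ⟨x, hx, rfl⟩⟩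
  have hm : ∀ x : P, (cylinderMap (MulEquiv.refl (G₁ × G₂)) φ₁ (D.sndCarrier (MulEquiv.refl _))
      ⟨x, hP x.2⟩ : G₁ × G₂) ∈ cylinder (MulEquiv.prodComm : G₁ × G₂ ≃* G₂ × G₁) (proj₂ P)
        (D.sndCarrier MulEquiv.prodComm) :=
    fun x => ⟨⟨x, x.2, rfl⟩, hle₁.2 (φ₁ (toProj₁ P x)).2⟩
  -- First apply `(φ₁, id)` restricted to `P`, landing in `T₁ × proj₂ P`, then `(id, φ₂)`.
  have hχ := D.mem_of_restrict h₁ hP (D.le_of_mem h₂).1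
    (((Subgroup.subtype _).comp ((cylinderMap (MulEquiv.refl (G₁ × G₂)) φ₁
      (D.sndCarrier (MulEquiv.refl _))).comp (Subgroup.inclusion hP))).codRestrict _ hm)
    fun _ => rfl
  exact D.mem_of_restrict (D.comp_mem hχ h₂) le_rfl hQ φ fun x => h x

/-- If `E` is least, its two factors are the candidates: for `D ∈ A₁`, pairing `D` with the second
factor of `E` gives a member of `A` above `E`, so the first factor of `E` lies below `D`.
Conversely, `E₁ × E₂` lies below the product of the factors of any `D ∈ A`, hence below `D`.
Existence of least elements is never assumed. -/
theorem isLeast_prod_iff {A₁ : Set (FusionSystem p G₁)} {A₂ : Set (FusionSystem p G₂)}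
    {A : Set (FusionSystem p (G₁ × G₂))} (h : ∀ D₁ ∈ A₁, ∀ D₂ ∈ A₂, D₁.prod D₂ ∈ A)
    (h₁ : ∀ D ∈ A, D.factor (MulEquiv.refl (G₁ × G₂)) ∈ A₁)
    (h₂ : ∀ D ∈ A, D.factor (MulEquiv.prodComm : G₁ × G₂ ≃* G₂ × G₁) ∈ A₂)
    (E : FusionSystem p (G₁ × G₂)) :
    IsLeast A E ↔ ∃ (E₁ : FusionSystem p G₁) (E₂ : FusionSystem p G₂),
      IsLeast A₁ E₁ ∧ IsLeast A₂ E₂ ∧ E = E₁.prod E₂ := by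
  constructor
  · rintro ⟨hE, hl⟩
    refine ⟨_, _, ⟨h₁ E hE, fun D hD => ?_⟩, ⟨h₂ E hE, fun D hD => ?_⟩,
      le_antisymm (hl (h _ (h₁ E hE) _ (h₂ E hE))) (prod_factor_le E)⟩
    · exact (isFactor_fst D _).factor_le (hl (h _ hD _ (h₂ E hE)))
    · exact (isFactor_snd _ D).factor_le (hl (h _ (h₁ E hE) _ hD))
  · rintro ⟨E₁, E₂, ⟨m₁, l₁⟩, ⟨m₂, l₂⟩, rfl⟩
    exact ⟨h _ m₁ _ m₂, fun D hD =>
      (prod_mono (l₁ (h₁ D hD)) (l₂ (h₂ D hD))).trans (prod_factor_le D)⟩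

theorem isOPowerP_prod_iff [Fact p.Prime] (E : FusionSystem p (G₁ × G₂)) :
    (F₁.prod F₂).IsOPowerP E ↔ ∃ (E₁ : FusionSystem p G₁) (E₂ : FusionSystem p G₂),
      F₁.IsOPowerP E₁ ∧ F₂.IsOPowerP E₂ ∧ E = E₁.prod E₂ :=
  isLeast_prod_iff (A₁ := {D | F₁.HasPPowerIndex D ∧ D.carrier = F₁.hyperfocal})
    (A₂ := {D | F₂.HasPPowerIndex D ∧ D.carrier = F₂.hyperfocal})
    (A := {D | (F₁.prod F₂).HasPPowerIndex D ∧ D.carrier = (F₁.prod F₂).hyperfocal})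
    (fun _ h₁ _ h₂ => ⟨h₁.1.prod h₂.1, (congrArg₂ Subgroup.prod h₁.2 h₂.2).trans
      (hyperfocal_prod F₁ F₂).symm⟩)
    (fun _ h => (isFactor_fst F₁ F₂).hasPPowerIndex_factor h.1 h.2)
    (fun _ h => (isFactor_snd F₁ F₂).hasPPowerIndex_factor h.1 h.2) E

theorem isOPowerPPrime_prod_iff [Fact p.Prime] (E : FusionSystem p (G₁ × G₂)) :
    (F₁.prod F₂).IsOPowerPPrime E ↔ ∃ (E₁ : FusionSystem p G₁) (E₂ : FusionSystem p G₂),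
      F₁.IsOPowerPPrime E₁ ∧ F₂.IsOPowerPPrime E₂ ∧ E = E₁.prod E₂ :=
  isLeast_prod_iff (A₁ := {D | F₁.HasIndexPrimeTo D}) (A₂ := {D | F₂.HasIndexPrimeTo D})
    (A := {D | (F₁.prod F₂).HasIndexPrimeTo D}) (fun _ h₁ _ h₂ => h₁.prod h₂)
    (fun _ h => (isFactor_fst F₁ F₂).hasIndexPrimeTo_factor h)
    (fun _ h => (isFactor_snd F₁ F₂).hasIndexPrimeTo_factor h) E

/-- Each system is the factor of its product, so the product determines it. -/
theorem eq_of_prod_eq {E₁ : FusionSystem p G₁} {E₂ : FusionSystem p G₂}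
    (h : F₁.prod F₂ = E₁.prod E₂) : F₁ = E₁ ∧ F₂ = E₂ :=
  ⟨le_antisymm ((isFactor_fst F₁ F₂).le_factor.trans ((isFactor_fst E₁ E₂).factor_le h.le))
      ((isFactor_fst E₁ E₂).le_factor.trans ((isFactor_fst F₁ F₂).factor_le h.ge)),
    le_antisymm ((isFactor_snd F₁ F₂).le_factor.trans ((isFactor_snd E₁ E₂).factor_le h.le))
      ((isFactor_snd E₁ E₂).le_factor.trans ((isFactor_snd F₁ F₂).factor_le h.ge))⟩

theorem reduced_prod_iff [Fact p.Prime] (hF₁ : F₁.Saturated) (hF₂ : F₂.Saturated) :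
    (F₁.prod F₂).Reduced ↔ F₁.Reduced ∧ F₂.Reduced := by
  constructor
  · intro h
    have hc := h.core_eq
    rw [core_prod, Subgroup.prod_eq_bot_iff] at hc
    obtain ⟨A₁, A₂, a₁, a₂, ha⟩ := (isOPowerP_prod_iff _).1 h.oPowerP
    obtain ⟨B₁, B₂, b₁, b₂, hb⟩ := (isOPowerPPrime_prod_iff _).1 h.oPowerPPrime
    obtain ⟨rfl, rfl⟩ := eq_of_prod_eq ha
    obtain ⟨rfl, rfl⟩ := eq_of_prod_eq hb
    exact ⟨⟨hF₁, hc.1, a₁, b₁⟩, ⟨hF₂, hc.2, a₂, b₂⟩⟩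
  · rintro ⟨h₁, h₂⟩
    refine ⟨hF₁.prod hF₂, ?_, (isOPowerP_prod_iff _).2 ⟨_, _, h₁.oPowerP, h₂.oPowerP, rfl⟩,
      (isOPowerPPrime_prod_iff _).2 ⟨_, _, h₁.oPowerPPrime, h₂.oPowerPPrime, rfl⟩⟩
    rw [core_prod, h₁.core_eq, h₂.core_eq, Subgroup.bot_prod_bot]

end Prod

end FusionSystem

theorem mainTheorem6 {p : ℕ} [Fact p.Prime] {G₁ G₂ : Type*} [Group G₁] [Group G₂]
    (F₁ : FusionSystem p G₁) (F₂ : FusionSystem p G₂)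
    (hF₁ : F₁.Saturated) (hF₂ : F₂.Saturated) :
    (F₁.prod F₂).Saturated ∧
    (F₁.prod F₂).core = F₁.core.prod F₂.core ∧
    (∀ E : FusionSystem p (G₁ × G₂), (F₁.prod F₂).IsOPowerP E ↔
      ∃ (E₁ : FusionSystem p G₁) (E₂ : FusionSystem p G₂),
        F₁.IsOPowerP E₁ ∧ F₂.IsOPowerP E₂ ∧ E = E₁.prod E₂) ∧
    (∀ E : FusionSystem p (G₁ × G₂), (F₁.prod F₂).IsOPowerPPrime E ↔
      ∃ (E₁ : FusionSystem p G₁) (E₂ : FusionSystem p G₂),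
        F₁.IsOPowerPPrime E₁ ∧ F₂.IsOPowerPPrime E₂ ∧ E = E₁.prod E₂) ∧
    ((F₁.prod F₂).Reduced ↔ F₁.Reduced ∧ F₂.Reduced) :=
  ⟨hF₁.prod hF₂, FusionSystem.core_prod F₁ F₂, FusionSystem.isOPowerP_prod_iff,
    FusionSystem.isOPowerPPrime_prod_iff, FusionSystem.reduced_prod_iff hF₁ hF₂⟩
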